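/- There is a function $b:\mathbb N\to\mathbb N$ such that the following holds for every field $k$, every $n\ge 0$ and $R=k[x_1,\dots,x_n]$. Let $\varphi:M\to N$ be a morphism of $R$-modules such that the diagram $M\xrightarrow{\varphi}N$ is computed by a colimit computation of size $s$ in the category of $R$-modules, with respect to the basic morphisms listed below. Then there is a colimit computation of size at most $b(s)$ that computes the diagram $\operatorname{im}(\varphi)\hookrightarrow N$. Here the basic morphisms are $R\xrightarrow{x_i}R$ for $i=1,\dots,n$, $R\xrightarrow{c}R$ for $c\in k$, the two inclusions $i_1,i_2:R\to R\oplus R$, the diagonal $\Delta:R\to R\oplus R$, the addition $+:R\oplus R\to R$, and $R\to\{0\}$. A diagram of shape $I$, where $I$ is a directed graph, assigns to every vertex of $I$ a module and to every edge a morphism from the module at its source to the module at its target; no commutativity is required. A colimit computation is a sequence of diagrams $(D_0,\dots,D_r)$, whose shapes $I_0\subseteq\dots\subseteq I_r$ are finite directed graphs, such that (i) every edge of $D_0$ is a basic morphism and every vertex of $I_0$ is an endpoint of an edge of $I_0$; (ii) for $1\le i\le r$, $D_i$ is obtained from $D_{i-1}$ by choosing a full subgraph $J_i$ of $I_{i-1}$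 and adding one new vertex $v_i$, carrying a colimit of $D_{i-1}|_{J_i}$, together with one edge from each vertex of $J_i$ to $v_i$, carrying the corresponding morphism of the colimit cocone; (iii) (constructivity) if $v_i$ is a vertex of $J_j$ for some $j>i$, then $J_i$ is a subgraph of $J_j$. The size of the computation is $r$ plus the number of edges of $I_0$. The computation computes a diagram $D$ if $D$ is isomorphic to a (not necessarily full) subdiagram of $D_r$; a morphism $X\to Y$ is regarded as a diagram whose shape has two distinct vertices and one edge. -/

import Mathlib

open CategoryTheory

universe u v w

/-- A (not necessarily full) subgraph of a directed graph: a set of vertices together with a set of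
edges whose endpoints are among these vertices. -/
structure DiSubgraph (V : Type) [Quiver.{0} V] where
  verts : Set V
  edges : Set (Quiver.Total V)
  left_mem : ∀ e ∈ edges, e.left ∈ verts
  right_mem : ∀ e ∈ edges, e.right ∈ verts

namespace DiSubgraph

variable {V : Type} [Quiver.{0} V]

/-- `H ≤ K` means that `H` is a subgraph of `K`. -/
instance : LE (DiSubgraph V) where
  le H K := H.verts ⊆ K.verts ∧ H.edges ⊆ K.edges

/-- `H` is a full subgraph of `K`: a subgraph that contains every edge of `K` whose endpoints both
lie in `H`. -/
def IsFullIn (H K : DiSubgraph V) : Prop :=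
  H ≤ K ∧ ∀ e ∈ K.edges, e.left ∈ H.verts → e.right ∈ H.verts → e ∈ H.edges

end DiSubgraph

section Diagrams

variable {C : Type u} [Category.{v} C] {V : Type} [Quiver.{0} V]

/-- The morphisms `φ a : D a ⟶ W`, for `a` a vertex of `J`, form a cocone with vertex `W` over the
restriction of the diagram `D` to the subgraph `J`. A diagram in `C` of shape `V` is a homomorphism
of directed graphs from `V` to the underlying graph of `C`. -/
def IsCoconeOn (D : V ⥤q C) (J : DiSubgraph V) (W : C)
    (φ : ∀ a : J.verts, D.obj a.1 ⟶ W) : Prop :=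
  ∀ (e : Quiver.Total V) (he : e ∈ J.edges),
    D.map e.hom ≫ φ ⟨e.right, J.right_mem e he⟩ = φ ⟨e.left, J.left_mem e he⟩

/-- The cocone `φ` with vertex `W` is a colimit of the restriction of `D` to `J`. -/
def IsColimitOn (D : V ⥤q C) (J : DiSubgraph V) (W : C)
    (φ : ∀ a : J.verts, D.obj a.1 ⟶ W) : Prop :=
  IsCoconeOn D J W φ ∧
    ∀ (X : C) (ψ : ∀ a : J.verts, D.obj a.1 ⟶ X), IsCoconeOn D J X ψ →
      ∃! t : W ⟶ X, ∀ a : J.verts, φ a ≫ t = ψ a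

/-- The diagram `F` is isomorphic to a (not necessarily full) subdiagram of `D`. -/
def IsIsoToSubdiagram {S : Type} [Quiver.{0} S] (F : S ⥤q C) (D : V ⥤q C) : Prop :=
  ∃ g : S ⥤q V,
    Function.Injective g.obj ∧
    (∀ a b : S, Function.Injective (fun e : a ⟶ b => g.map e)) ∧
    ∃ α : ∀ a : S, F.obj a ≅ D.obj (g.obj a),
      ∀ (a b : S) (e : a ⟶ b), F.map e ≫ (α b).hom = (α a).hom ≫ D.map (g.map e)

end Diagrams

/-- A colimit computation `(D₀, …, Dₛ)` in `C` with basic morphisms `A`. Since each `Dᵢ` is the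
restriction of `Dₛ` to the shape `Iᵢ` of `Dᵢ`, the computation is recorded by the last diagram `Dₛ`
(of shape `V`) together with the increasing sequence of subgraphs `I₀, …, Iₛ` of `V`. -/
structure ColimitComputation {C : Type u} [Category.{v} C] (A : MorphismProperty C) where
  /-- the vertices of the shape of the last diagram -/
  V : Type
  [quiver : Quiver.{0} V]
  [finite_verts : Finite V]
  [finite_edges : Finite (Quiver.Total V)]
  /-- the last diagram `Dₛ` -/
  diagram : V ⥤q C
  /-- the number `s` of colimit steps -/
  steps : ℕ
  /-- the shapes `I₀, …, Iₛ` -/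
  shape : Fin (steps + 1) → DiSubgraph V
  shape_last_verts : (shape (Fin.last steps)).verts = Set.univ
  shape_last_edges : (shape (Fin.last steps)).edges = Set.univ
  /-- every edge of `D₀` is a basic morphism -/
  basic : ∀ e ∈ (shape 0).edges, A (diagram.map e.hom)
  /-- `D₀` consists of basic morphisms only: it has no isolated vertices -/
  no_isolated : ∀ a ∈ (shape 0).verts, ∃ e ∈ (shape 0).edges, e.left = a ∨ e.right = a
  /-- the shape of the subdiagram whose colimit is added in the given step -/
  sub : Fin steps → DiSubgraph V
  sub_full : ∀ i : Fin steps, (sub i).IsFullIn (shape i.castSucc)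
  /-- the vertex added in the given step -/
  apex : Fin steps → V
  apex_new : ∀ i : Fin steps, apex i ∉ (shape i.castSucc).verts
  /-- the edges (cocone morphisms) added in the given step -/
  leg : ∀ (i : Fin steps) (a : (sub i).verts), a.1 ⟶ apex i
  verts_succ : ∀ i : Fin steps,
    (shape i.succ).verts = insert (apex i) (shape i.castSucc).verts
  edges_succ : ∀ i : Fin steps,
    (shape i.succ).edges = (shape i.castSucc).edges ∪
      Set.range (fun a : (sub i).verts => Quiver.Total.mk a.1 (apex i) (leg i a))
  isColimit : ∀ i : Fin steps,
    IsColimitOn diagram (sub i) (diagram.obj (apex i)) (fun a => diagram.map (leg i a))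
  /-- a colimit can be used again only together with the subdiagram that produced it -/
  constructive : ∀ i j : Fin steps, i < j → apex i ∈ (sub j).verts → sub i ≤ sub j

attribute [instance] ColimitComputation.quiver ColimitComputation.finite_verts
  ColimitComputation.finite_edges

namespace ColimitComputation

variable {C : Type u} [Category.{v} C] {A : MorphismProperty C}

/-- The size (cost) of a computation: the number of steps plus the number of basic morphisms, that
is, of edges of the initial diagram. -/
noncomputable def size (P : ColimitComputation A) : ℕ :=
  P.steps + (P.shape 0).edges.ncard

/-- The computation `P` computes the diagram `F`. -/
def Computes (P : ColimitComputation A) {S : Type} [Quiver.{0} S] (F : S ⥤q C) : Prop :=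
  IsIsoToSubdiagram F P.diagram

end ColimitComputation

/-- The vertices of the directed graph `• → •` with two distinct vertices and one edge. -/
inductive ArrowGraph : Type
  | source
  | target

/-- The single edge of `• → •`. -/
inductive ArrowGraph.Edge : ArrowGraph → ArrowGraph → Type
  | edge : ArrowGraph.Edge ArrowGraph.source ArrowGraph.target

instance : Quiver.{0} ArrowGraph where
  Hom := ArrowGraph.Edge

/-- A morphism `f : X ⟶ Y`, regarded as a diagram of shape `• → •`. -/
def morphismDiagram {C : Type u} [Category.{v} C] {X Y : C} (f : X ⟶ Y) : ArrowGraph ⥤q C where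
  obj a := match a with
    | ArrowGraph.source => X
    | ArrowGraph.target => Y
  map e := match e with
    | ArrowGraph.Edge.edge => f

/-- The basic morphisms in the category of modules over `R = k[x₁, …, xₙ]`. -/
inductive PolyModBasic (k : Type w) [Field k] (n : ℕ) :
    MorphismProperty (ModuleCat.{w} (MvPolynomial (Fin n) k))
  /-- multiplication by a variable `R → R` -/
  | var (i : Fin n) : PolyModBasic k n
      (ModuleCat.ofHom (LinearMap.lsmul (MvPolynomial (Fin n) k) (MvPolynomial (Fin n) k)
        (MvPolynomial.X i)))
  /-- multiplication by a constant `R → R` -/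
  | const (c : k) : PolyModBasic k n
      (ModuleCat.ofHom (LinearMap.lsmul (MvPolynomial (Fin n) k) (MvPolynomial (Fin n) k)
        (MvPolynomial.C c)))
  /-- the first inclusion `R → R ⊕ R` -/
  | inl : PolyModBasic k n
      (ModuleCat.ofHom (LinearMap.inl (MvPolynomial (Fin n) k)
        (MvPolynomial (Fin n) k) (MvPolynomial (Fin n) k)))
  /-- the second inclusion `R → R ⊕ R` -/
  | inr : PolyModBasic k n
      (ModuleCat.ofHom (LinearMap.inr (MvPolynomial (Fin n) k)
        (MvPolynomial (Fin n) k) (MvPolynomial (Fin n) k)))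
  /-- the diagonal `R → R ⊕ R` -/
  | diag : PolyModBasic k n
      (ModuleCat.ofHom (LinearMap.prod
        (LinearMap.id : MvPolynomial (Fin n) k →ₗ[MvPolynomial (Fin n) k] MvPolynomial (Fin n) k)
        LinearMap.id))
  /-- the addition `R ⊕ R → R` -/
  | add : PolyModBasic k n
      (ModuleCat.ofHom (LinearMap.coprod
        (LinearMap.id : MvPolynomial (Fin n) k →ₗ[MvPolynomial (Fin n) k] MvPolynomial (Fin n) k)
        LinearMap.id))
  /-- the zero map `R → {0}` -/
  | zero : PolyModBasic k n
      (ModuleCat.ofHom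
        (0 : MvPolynomial (Fin n) k →ₗ[MvPolynomial (Fin n) k] PUnit.{w + 1}))

/-!
Kernels cannot be computed directly by colimits, but they can be bounded. By constructivity, every
colimit of a computation of size `s` is already the colimit of the part of its subdiagram that lies
in the initial diagram. So the target of every edge has a presentation with `O(s)` generators and
relations, whose coefficients are affine linear forms in at most `s` of the variables, and the image
of the edge is generated by `O(s)` such affine combinations of the generators. The relations between
the generators of the image are the syzygies of the matrix of all these coefficients.

Up to substitution, there are only finitely many families of such matrices for each `s`, and the
coefficients of the affine linear forms are the parameters of a family. By Noetherian induction on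
the parameters, finitely many vectors that are polynomial in the parameters contain generators of
the syzygies for all values of the parameters in all fields: a generic choice of syzygies with
leading terms as in Dickson's lemma works on a nonempty open set. Computing the terms of these
vectors one operation after the other takes a number of gates that depends only on `s`, and a
circuit of basic morphisms, followed by two colimits, yields the image and its inclusion.
-/

section LeadingIndex

/-- `b` is the largest index at which the family `w` does not vanish. -/
def IsLeadingIndex {A B : Type*} [Zero A] [LT B] (w : B → A) (b : B) : Prop :=
  w b ≠ 0 ∧ ∀ c, b < c → w c = 0

theorem exists_isLeadingIndex {A B : Type*} [Zero A] [LinearOrder B] {w : B → A}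
    (hfin : (Function.support w).Finite) (hw : w ≠ 0) : ∃ b, IsLeadingIndex w b := by
  obtain ⟨b, hb⟩ := hfin.exists_maximal (Function.support_nonempty_iff.2 hw)
  exact ⟨b, hb.prop, fun c hc => by_contra fun h => (hb.le_of_ge h hc.le).not_gt hc⟩

theorem linearIndependent_of_isLeadingIndex {k B ι : Type*} [Field k] [LinearOrder B]
    {w : ι → B → k} {b : ι → B} (hb : Function.Injective b)
    (hw : ∀ i, IsLeadingIndex (w i) (b i)) : LinearIndependent k w := by
  classical
  refine linearIndependent_iff'.2 fun s a ha => ?_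
  by_contra! hs
  obtain ⟨i₀, hi₀, h₀⟩ := hs
  obtain ⟨i, hi, hmax⟩ := ({j ∈ s | a j ≠ 0}).exists_max_image b ⟨i₀, by simp [hi₀, h₀]⟩
  rw [Finset.mem_filter] at hi
  have hzero : ∀ j ∈ s, j ≠ i → a j * w j (b i) = 0 := by
    intro j hj hji
    by_cases haj : a j = 0
    · rw [haj, zero_mul]
    · have hlt := (hmax j (Finset.mem_filter.2 ⟨hj, haj⟩)).lt_of_ne (hb.ne hji)
      rw [(hw j).2 _ hlt, mul_zero]
  have hsum : ∑ j ∈ s, a j * w j (b i) = 0 := by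
    simpa only [Finset.sum_apply, Pi.smul_apply, smul_eq_mul, Pi.zero_apply] using congrFun ha (b i)
  rw [Finset.sum_eq_single_of_mem i hi.1 hzero] at hsum
  exact mul_ne_zero hi.2 (hw i).1 hsum

variable {A k E E' B : Type*} [CommRing A] [Field k] [AddCommGroup E] [Module A E]
  [AddCommGroup E'] [Module k E'] [LinearOrder B] [WellFoundedLT B] {φ : A →+* k}

theorem map_mem_span_sup_of_isLeadingIndex {S : Set B} {g : S → E} (Φ : E →ₛₗ[φ] E')
    (coef : E →ₗ[A] B → A) (hfin : ∀ v, (Function.support (coef v)).Finite)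
    (hS : ∀ v b, IsLeadingIndex (coef v) b → b ∈ S)
    (hg : ∀ b, IsLeadingIndex (coef (g b)) b) (hφ : ∀ b, φ (coef (g b) b) ≠ 0) (v : E) :
    Φ v ∈ Submodule.span k (Set.range fun b => Φ (g b)) ⊔
      Submodule.span k (Φ '' LinearMap.ker coef) := by
  by_cases h0 : coef v = 0
  · exact Submodule.mem_sup_right (Submodule.subset_span ⟨v, h0, rfl⟩)
  obtain ⟨b, hb⟩ := exists_isLeadingIndex (hfin v) h0
  induction b using WellFoundedLT.induction generalizing v with
  | ind b ih =>
    lift b to S using hS v b hb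
    let v' := coef (g b) b • v - coef v b • g b
    have hv' : ∀ c, (b : B) ≤ c → coef v' c = 0 := by
      intro c hc
      rcases hc.eq_or_lt with rfl | hc
      · simp [v', mul_comm]
      · simp [v', hb.2 c hc, (hg b).2 c hc]
    have hΦ : Φ v = (φ (coef (g b) b))⁻¹ • (Φ v' + φ (coef v b) • Φ (g b)) := by
      simp only [v', map_sub, map_smulₛₗ, sub_add_cancel, inv_smul_smul₀ (hφ b)]
    rw [hΦ]
    refine Submodule.smul_mem _ _ (Submodule.add_mem _ ?_ (Submodule.mem_sup_left
      (Submodule.smul_mem _ _ (Submodule.subset_span ⟨b, rfl⟩))))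
    by_cases h0' : coef v' = 0
    · exact Submodule.mem_sup_right (Submodule.subset_span ⟨v', h0', rfl⟩)
    · obtain ⟨c, hc⟩ := exists_isLeadingIndex (hfin v') h0'
      exact ih c (not_le.1 fun h => hc.1 (hv' c h)) v' h0' hc

theorem mem_span_image_ker_of_isLeadingIndex (Φ : E →ₛₗ[φ] E') (coef : E →ₗ[A] B → A)
    (coef' : E' →ₗ[k] B → k) (hcoef : ∀ v b, coef' (Φ v) b = φ (coef v b))
    (hfin : ∀ v, (Function.support (coef v)).Finite)
    (hlead : ∀ v b, IsLeadingIndex (coef v) b →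
      ∃ g, IsLeadingIndex (coef g) b ∧ φ (coef g b) ≠ 0)
    {x : E'} (hx : x ∈ Submodule.span k (Set.range Φ)) (hx0 : coef' x = 0) :
    x ∈ Submodule.span k (Φ '' LinearMap.ker coef) := by
  let S : Set B := {b | ∃ g, IsLeadingIndex (coef g) b ∧ φ (coef g b) ≠ 0}
  choose g hg hφ using fun b : S => b.2
  have hker : ∀ y ∈ Submodule.span k (Φ '' LinearMap.ker coef), coef' y = 0 := by
    refine fun y hy => Submodule.span_le (p := LinearMap.ker coef').2 ?_ hy
    rintro _ ⟨v, hv, rfl⟩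
    funext b
    rw [hcoef, LinearMap.mem_ker.1 hv, Pi.zero_apply, Pi.zero_apply, map_zero]
  have hindep : LinearIndependent k (coef' ∘ fun b : S => Φ (g b)) :=
    linearIndependent_of_isLeadingIndex Subtype.val_injective fun b =>
      ⟨by simpa [hcoef] using hφ b, fun c hc => by simp [hcoef, (hg b).2 c hc]⟩
  have hspan := Submodule.span_le.2 (Set.range_subset_iff.2
    (map_mem_span_sup_of_isLeadingIndex Φ coef hfin hlead hg hφ)) hx
  obtain ⟨y, hy, z, hz, rfl⟩ := Submodule.mem_sup.1 hspan
  have hy0 : coef' y = 0 := by simpa [hker z hz] using hx0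
  rwa [Submodule.disjoint_def.1 (Submodule.range_ker_disjoint hindep) y hy hy0, zero_add]

end LeadingIndex

section LeadingCoeff

open MvPolynomial

variable {A σ ι : Type*} [CommRing A] (m : MonomialOrder σ)

/-- The coefficients of a vector of polynomials, as a family indexed by the pairs (entry, monomial)
in lexicographic order. -/
noncomputable def vecCoeff : (ι → MvPolynomial σ A) →ₗ[A] (ι ×ₗ m.syn → A) where
  toFun w b := coeff (m.toSyn.symm (ofLex b).2) (w (ofLex b).1)
  map_add' _ _ := rfl
  map_smul' _ _ := funext fun _ => coeff_smul _ _ _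

variable {m}

theorem vecCoeff_toLex (w : ι → MvPolynomial σ A) (i : ι) (s : m.syn) :
    vecCoeff m w (toLex (i, s)) = coeff (m.toSyn.symm s) (w i) := rfl

theorem finite_support_vecCoeff [Finite ι] (w : ι → MvPolynomial σ A) :
    (Function.support (vecCoeff m w)).Finite := by
  refine (Set.finite_iUnion fun i : ι =>
    (w i).support.finite_toSet.image fun a => toLex (i, m.toSyn a)).subset fun b hb => ?_
  exact Set.mem_iUnion.2 ⟨(ofLex b).1, m.toSyn.symm (ofLex b).2, mem_support_iff.2 hb, by simp⟩

theorem vecCoeff_eq_zero_iff {w : ι → MvPolynomial σ A} : vecCoeff m w = 0 ↔ w = 0 := by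
  refine ⟨fun h => funext fun i => MvPolynomial.ext _ _ fun a => ?_, fun h => by rw [h, map_zero]⟩
  simpa [vecCoeff_toLex] using congrFun h (toLex (i, m.toSyn a))

theorem vecCoeff_monomial_smul (d : σ →₀ ℕ) (w : ι → MvPolynomial σ A) (i : ι) (s : m.syn) :
    vecCoeff m (monomial d (1 : A) • w) (toLex (i, m.toSyn d + s)) =
      vecCoeff m w (toLex (i, s)) := by
  simp [vecCoeff_toLex, coeff_monomial_mul]

variable [LinearOrder ι]

theorem IsLeadingIndex.monomial_smul {w : ι → MvPolynomial σ A} {i : ι} {s : m.syn}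
    (h : IsLeadingIndex (vecCoeff m w) (toLex (i, s))) (d : σ →₀ ℕ) :
    IsLeadingIndex (vecCoeff m (monomial d (1 : A) • w)) (toLex (i, m.toSyn d + s)) := by
  refine ⟨by rw [vecCoeff_monomial_smul]; exact h.1, fun c hc => ?_⟩
  obtain ⟨j, t, rfl⟩ : ∃ j t, c = toLex (j, m.toSyn t) :=
    ⟨(ofLex c).1, m.toSyn.symm (ofLex c).2, by simp⟩
  by_cases hd : d ≤ t
  · obtain ⟨t, rfl⟩ := exists_add_of_le hd
    rw [map_add, vecCoeff_monomial_smul]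
    refine h.2 _ ?_
    simpa only [map_add, Prod.Lex.toLex_lt_toLex, add_lt_add_iff_left] using hc
  · simp [vecCoeff_toLex, coeff_monomial_mul', hd]

theorem exists_ne_zero_forall_leadingCoeff_dvd [IsDomain A] [Finite ι] [Finite σ]
    (W : Submodule (MvPolynomial σ A) (ι → MvPolynomial σ A)) :
    ∃ f : A, f ≠ 0 ∧ ∀ w ∈ W, ∀ b, IsLeadingIndex (vecCoeff m w) b →
      ∃ g ∈ W, IsLeadingIndex (vecCoeff m g) b ∧ vecCoeff m g b ∣ f := by
  classical
  have := Fintype.ofFinite ι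
  let leadingExps (i : ι) : Set (σ →₀ ℕ) :=
    {a | ∃ w ∈ W, IsLeadingIndex (vecCoeff m w) (toLex (i, m.toSyn a))}
  -- Dickson's lemma
  have hfin (i) : {a | Minimal (· ∈ leadingExps i) a}.Finite :=
    WellQuasiOrderedLE.finite_of_isAntichain (setOfPred_minimal_antichain _)
  have hex (i a) : ∃ g ∈ W, a ∈ leadingExps i →
      IsLeadingIndex (vecCoeff m g) (toLex (i, m.toSyn a)) := by
    by_cases ha : a ∈ leadingExps i
    · exact ha.imp fun g hg => ⟨hg.1, fun _ => hg.2⟩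
    · exact ⟨0, W.zero_mem, fun h => (ha h).elim⟩
  choose g hgW hg using hex
  let c (i a) : A := vecCoeff m (g i a) (toLex (i, m.toSyn a))
  refine ⟨∏ i, ∏ a ∈ (hfin i).toFinset, c i a, ?_, fun w hw b hb => ?_⟩
  · refine Finset.prod_ne_zero_iff.2 fun i _ => Finset.prod_ne_zero_iff.2 fun a ha => ?_
    exact (hg i a ((hfin i).mem_toFinset.1 ha).prop).1
  · obtain ⟨i, t, rfl⟩ : ∃ i t, b = toLex (i, m.toSyn t) :=
      ⟨(ofLex b).1, m.toSyn.symm (ofLex b).2, by simp⟩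
    obtain ⟨a, hat, ha⟩ := Set.IsPWO.exists_le_minimal (s := leadingExps i)
      (Set.isPWO_of_wellQuasiOrderedLE _) ⟨w, hw, hb⟩
    have hlead := (hg i a ha.prop).monomial_smul (t - a)
    rw [← map_add, tsub_add_cancel_of_le hat] at hlead
    refine ⟨_, W.smul_mem _ (hgW i a), hlead, ?_⟩
    have hcoeff := vecCoeff_monomial_smul (t - a) (g i a) i (m.toSyn a)
    rw [← map_add, tsub_add_cancel_of_le hat] at hcoeff
    rw [hcoeff]
    exact (Finset.dvd_prod_of_mem (c i) ((hfin i).mem_toFinset.2 ha)).trans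
      (Finset.dvd_prod_of_mem (fun i => ∏ a ∈ (hfin i).toFinset, c i a) (Finset.mem_univ i))

end LeadingCoeff

section Syzygies

variable {A S S' S'' ι κ : Type*} [CommRing A] [CommRing S] [CommRing S'] [CommRing S'']

/-- Entrywise application of a ring homomorphism, as a semilinear map of free modules. -/
def entrywise (f : S →+* S') : (κ → S) →ₛₗ[f] (κ → S') where
  toFun v := f ∘ v
  map_add' _ _ := funext fun _ => map_add f _ _
  map_smul' _ _ := funext fun _ => map_mul f _ _

theorem entrywise_comp (f : S →+* S') (g : S' →+* S'') (v : κ → S) :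
    entrywise (g.comp f) v = entrywise g (entrywise f v) := rfl

theorem entrywise_mem_span (f : S →+* S') {T : Set (κ → S)} {v : κ → S}
    (hv : v ∈ Submodule.span S T) :
    entrywise f v ∈ Submodule.span S' (entrywise f '' T) := by
  induction hv using Submodule.span_induction with
  | mem v hv => exact Submodule.subset_span ⟨v, hv, rfl⟩
  | zero => rw [map_zero]; exact Submodule.zero_mem _
  | add v v' _ _ h h' => rw [map_add]; exact Submodule.add_mem _ h h'
  | smul r v _ h => rw [map_smulₛₗ]; exact Submodule.smul_mem _ _ h

variable [Fintype κ]

/-- The kernel of the matrix obtained from `M` by applying `f` to its entries. -/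
def syzygies (f : S →+* S') (M : Matrix ι κ S) : Submodule S' (κ → S') :=
  LinearMap.ker (M.map f).mulVecLin

theorem mem_syzygies {f : S →+* S'} {M : Matrix ι κ S} {x : κ → S'} :
    x ∈ syzygies f M ↔ (M.map f).mulVec x = 0 := Iff.rfl

theorem mulVec_entrywise (f : S →+* S') (M : Matrix ι κ S) (v : κ → S) :
    (M.map f).mulVec (entrywise f v) = entrywise f (M.mulVec v) :=
  funext fun i => (RingHom.map_mulVec f M v i).symm

/-- `T` generates the syzygies of `M` along `f`: the vectors of `T` whose images under `f` are
syzygies of the image of `M` generate all these syzygies. -/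
def GeneratesSyzygies (f : S →+* S') (M : Matrix ι κ S) (T : Set (κ → S)) : Prop :=
  syzygies f M ≤ Submodule.span S' (entrywise f '' T ∩ syzygies f M)

theorem GeneratesSyzygies.mono {f : S →+* S'} {M : Matrix ι κ S} {T T' : Set (κ → S)}
    (h : GeneratesSyzygies f M T) (hT : T ⊆ T') : GeneratesSyzygies f M T' :=
  h.trans (Submodule.span_mono (Set.inter_subset_inter_left _ (Set.image_mono hT)))

theorem GeneratesSyzygies.comp_of_image {f : S →+* S'} {g : S' →+* S''} {M : Matrix ι κ S}
    {T : Set (κ → S)} (h : GeneratesSyzygies g (M.map f) (entrywise f '' T)) :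
    GeneratesSyzygies (g.comp f) M T := by
  simpa only [GeneratesSyzygies, syzygies, Matrix.map_map, Set.image_image, ← entrywise_comp,
    RingHom.coe_comp] using h

theorem syzygies_algebraMap_le_span [Finite ι] [Algebra S S'] [Module.Flat S S']
    (M : Matrix ι κ S) :
    syzygies (algebraMap S S') M ≤
      Submodule.span S' (entrywise (algebraMap S S') '' LinearMap.ker M.mulVecLin) := by
  classical
  have := Fintype.ofFinite ι
  intro x hx
  have hrel : Fintype.linearCombination S x ∘ₗ M.vecMulLinear = 0 := by
    refine LinearMap.pi_ext' fun i => LinearMap.ext_ring ?_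
    simpa [Matrix.mulVec, dotProduct, Fintype.linearCombination_apply, Algebra.smul_def,
      Matrix.row] using congrFun (mem_syzygies.1 hx) i
  obtain ⟨k, a, y, hxy, ha⟩ := Module.Flat.exists_factorization_of_comp_eq_zero_of_free hrel
  have hx' : x = ∑ l, y (Finsupp.single l 1) •
      entrywise (algebraMap S S') fun j => a (Pi.single j 1) l := by
    funext j
    have hj := LinearMap.congr_fun hxy (Pi.single j 1)
    rw [Fintype.linearCombination_apply_single, one_smul, LinearMap.comp_apply,
      ← Finsupp.univ_sum_single (a _), map_sum] at hj
    rw [hj, Finset.sum_apply]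
    refine Finset.sum_congr rfl fun l _ => ?_
    rw [← Finsupp.smul_single_one, map_smul, Algebra.smul_def, mul_comm]
    rfl
  rw [hx']
  refine Submodule.sum_mem _ fun l _ => Submodule.smul_mem _ _ (Submodule.subset_span ⟨_, ?_, rfl⟩)
  rw [SetLike.mem_coe, LinearMap.mem_ker]
  funext i
  have hi := DFunLike.congr_fun (LinearMap.congr_fun ha (Pi.single i 1)) l
  have hrow : M i = ∑ j, M i j • Pi.single j 1 := by
    simp [← Pi.single_smul', Finset.univ_sum_single]
  rw [LinearMap.comp_apply, Matrix.vecMulLinear_apply, Matrix.single_one_vecMul, Matrix.row,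
    hrow, map_sum, Finsupp.finsetSum_apply] at hi
  simp only [map_smul, Finsupp.smul_apply, smul_eq_mul] at hi
  exact hi

theorem GeneratesSyzygies.comp_of_flat [Finite ι] {f : S →+* S'} {g : S' →+* S''} (hg : g.Flat)
    {M : Matrix ι κ S} {T : Set (κ → S)} (h : GeneratesSyzygies f M T) :
    GeneratesSyzygies (g.comp f) M T := by
  algebraize [g]
  refine .comp_of_image fun x hx => ?_
  refine (Submodule.span_le.2 ?_) (syzygies_algebraMap_le_span _ hx)
  rintro _ ⟨y, hy, rfl⟩
  refine Submodule.span_mono ?_ (entrywise_mem_span g (h hy))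
  rintro _ ⟨_, ⟨⟨v, hv, rfl⟩, hv'⟩, rfl⟩
  refine ⟨⟨_, ⟨v, hv, rfl⟩, rfl⟩, ?_⟩
  rw [SetLike.mem_coe, mem_syzygies] at hv' ⊢
  rw [mulVec_entrywise, hv', map_zero]

end Syzygies

section UniformSyzygies

open MvPolynomial

variable {A σ ι κ : Type*} [CommRing A]

theorem span_range_entrywise_map [Finite κ] {k : Type*} [Field k] (φ : A →+* k) :
    Submodule.span k (Set.range (entrywise (κ := κ) (map (σ := σ) φ))) = ⊤ := by
  classical
  have := Fintype.ofFinite κ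
  have hsingle (j : κ) (p : MvPolynomial σ k) :
      Pi.single j p ∈ Submodule.span k (Set.range (entrywise (map φ))) := by
    induction p using MvPolynomial.induction_on' with
    | monomial a c =>
      have h : (Pi.single j (monomial a c) : κ → MvPolynomial σ k) =
          c • entrywise (map φ) (Pi.single j (monomial a 1)) := by
        ext i : 1
        by_cases hi : i = j
        · subst hi
          simp [entrywise, smul_monomial]
        · simp [entrywise, hi]
      rw [h]
      exact Submodule.smul_mem _ _ (Submodule.subset_span ⟨_, rfl⟩)
    | add p q hp hq =>
      rw [Pi.single_add]
      exact Submodule.add_mem _ hp hq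
  refine eq_top_iff.2 fun x _ => ?_
  rw [← Finset.univ_sum_single x]
  exact Submodule.sum_mem _ fun j _ => hsingle j _

variable [Fintype κ]

theorem exists_ne_zero_forall_syzygies_le_span [IsDomain A] [Finite σ] [Finite ι]
    (M : Matrix ι κ (MvPolynomial σ A)) :
    ∃ f : A, f ≠ 0 ∧ ∀ (k : Type w) [Field k] (φ : A →+* k), φ f ≠ 0 →
      syzygies (map φ) M ≤ Submodule.span (MvPolynomial σ k)
        (entrywise (map φ) '' LinearMap.ker M.mulVecLin) := by
  let : LinearOrder ι := LinearOrder.lift' _ (Finite.equivFin ι).injective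
  let : LinearOrder σ := LinearOrder.lift' _ (Finite.equivFin σ).injective
  let m : MonomialOrder σ := MonomialOrder.lex
  obtain ⟨f, hf, hdvd⟩ :=
    exists_ne_zero_forall_leadingCoeff_dvd (m := m) (LinearMap.range M.mulVecLin)
  refine ⟨f, hf, fun k _ φ hφ x hx => ?_⟩
  let Φ : (κ → MvPolynomial σ A) →ₛₗ[φ] (κ → MvPolynomial σ k) :=
    { entrywise (map φ) with
      map_smul' := fun a v => by
        funext j
        simp [entrywise, smul_eq_C_mul] }
  have htop : Submodule.span k (Set.range Φ) = ⊤ := span_range_entrywise_map φ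
  have key := mem_span_image_ker_of_isLeadingIndex Φ
    ((vecCoeff m).comp (M.mulVecLin.restrictScalars A))
    ((vecCoeff m).comp ((M.map (map φ)).mulVecLin.restrictScalars k))
    (fun v b => ?_) (fun v => ?_) (fun v b hb => ?_)
    (x := x) (htop ▸ Submodule.mem_top) (vecCoeff_eq_zero_iff.2 hx)
  · refine Submodule.span_le_restrictScalars k (MvPolynomial σ k) _
      (Submodule.span_mono (Set.image_mono fun v hv => vecCoeff_eq_zero_iff.1 hv) key)
  · change vecCoeff m ((M.map (map φ)).mulVec (entrywise (map φ) v)) b = _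
    rw [mulVec_entrywise]
    exact coeff_map φ _ _
  · exact finite_support_vecCoeff (M.mulVec v)
  · obtain ⟨_, ⟨g, rfl⟩, hg, hgf⟩ := hdvd _ ⟨v, rfl⟩ b hb
    exact ⟨g, hg, fun h => hφ (zero_dvd_iff.1 (h ▸ map_dvd φ hgf))⟩

theorem exists_generatesSyzygies_of_isDomain [IsDomain A] [IsNoetherianRing A] [Finite σ]
    [Finite ι] (M : Matrix ι κ (MvPolynomial σ A)) :
    ∃ f : A, f ≠ 0 ∧ ∃ T : Set (κ → MvPolynomial σ A), T.Finite ∧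
      ∀ (k : Type w) [Field k] (φ : A →+* k), φ f ≠ 0 → GeneratesSyzygies (map φ) M T := by
  obtain ⟨f, hf, hspan⟩ := exists_ne_zero_forall_syzygies_le_span M
  obtain ⟨T, hT⟩ : (LinearMap.ker M.mulVecLin).FG := IsNoetherian.noetherian _
  refine ⟨f, hf, T, T.finite_toSet, fun k _ φ hφ => (hspan k φ hφ).trans (Submodule.span_le.2 ?_)⟩
  rintro _ ⟨v, hv, rfl⟩
  refine Submodule.span_mono ?_ (entrywise_mem_span (map φ) (hT ▸ hv))
  rintro _ ⟨t, ht, rfl⟩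
  have ht0 : M.mulVec t = 0 := hT.le (Submodule.subset_span ht)
  refine ⟨⟨t, ht, rfl⟩, ?_⟩
  rw [SetLike.mem_coe, mem_syzygies, mulVec_entrywise, ht0, map_zero]

theorem exists_generatesSyzygies_of_isPrime [IsNoetherianRing A] [Finite σ] [Finite ι]
    (M : Matrix ι κ (MvPolynomial σ A)) (I : Ideal A) [I.IsPrime]
    (ih : ∀ J > I, ∃ T : Set (κ → MvPolynomial σ A), T.Finite ∧
      ∀ (k : Type w) [Field k] (φ : A →+* k), J ≤ RingHom.ker φ →
        GeneratesSyzygies (map φ) M T) :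
    ∃ T : Set (κ → MvPolynomial σ A), T.Finite ∧
      ∀ (k : Type w) [Field k] (φ : A →+* k), I ≤ RingHom.ker φ →
        GeneratesSyzygies (map φ) M T := by
  let π := Ideal.Quotient.mk I
  obtain ⟨f', hf', T', hT'fin, hT'⟩ := exists_generatesSyzygies_of_isDomain.{w} (M.map (map π))
  obtain ⟨f, rfl⟩ := Ideal.Quotient.mk_surjective f'
  have hfI : f ∉ I := fun h => hf' (Ideal.Quotient.eq_zero_iff_mem.2 h)
  obtain ⟨T₁, hT₁fin, hT₁⟩ := ih (I ⊔ Ideal.span {f}) (by simpa using hfI)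
  obtain ⟨T₂, hT₂fin, rfl⟩ : ∃ T₂ : Set (κ → MvPolynomial σ A), T₂.Finite ∧
      entrywise (map π) '' T₂ = T' := by
    have hsurj : Function.Surjective (entrywise (κ := κ) (map (σ := σ) π)) :=
      (map_surjective π Ideal.Quotient.mk_surjective).comp_left
    exact ⟨_, hT'fin.image _, (Function.rightInverse_surjInv hsurj).image_image T'⟩
  refine ⟨T₁ ∪ T₂, hT₁fin.union hT₂fin, fun k _ φ hφ => ?_⟩
  by_cases h0 : φ f = 0
  · refine (hT₁ k φ (sup_le hφ ?_)).mono Set.subset_union_left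
    rwa [Ideal.span_singleton_le_iff_mem]
  · obtain ⟨ψ, rfl⟩ : ∃ ψ : A ⧸ I →+* k, φ = ψ.comp π :=
      ⟨Ideal.Quotient.lift I φ fun a ha => hφ ha, rfl⟩
    have h := (hT' k ψ h0).comp_of_image
    rw [show (map ψ).comp (map π) = map (ψ.comp π) from RingHom.ext fun p => map_map π ψ p] at h
    exact h.mono Set.subset_union_right

theorem exists_generatesSyzygies_of_le_ker [IsNoetherianRing A] [Finite σ] [Finite ι]
    (M : Matrix ι κ (MvPolynomial σ A)) (I : Ideal A) :
    ∃ T : Set (κ → MvPolynomial σ A), T.Finite ∧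
      ∀ (k : Type w) [Field k] (φ : A →+* k), I ≤ RingHom.ker φ →
        GeneratesSyzygies (map φ) M T := by
  induction I using IsNoetherian.induction with
  | hgt I ih =>
    choose T hTfin hT using fun p : Ideal.minimalPrimes I =>
      have := p.2.isPrime
      exists_generatesSyzygies_of_isPrime M p fun J hJ => ih J (p.2.1.2.trans_lt hJ)
    have := (Ideal.finite_minimalPrimes_of_isNoetherianRing A I).to_subtype
    refine ⟨⋃ p, T p, Set.finite_iUnion hTfin, fun k _ φ hφ => ?_⟩
    have := RingHom.ker_isPrime φ
    obtain ⟨p, hp, hpφ⟩ := Ideal.exists_minimalPrimes_le hφ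
    exact (hT ⟨p, hp⟩ k φ hpφ).mono (Set.subset_iUnion _ _)

theorem flat_rename {k τ : Type*} [CommRing k] {g : σ → τ} (hg : Function.Injective g) :
    (rename g : MvPolynomial σ k →ₐ[k] MvPolynomial τ k).toRingHom.Flat := by
  classical
  let e₁ : (↥(Set.range g)ᶜ ⊕ σ) ≃ τ :=
    (Equiv.sumComm _ _).trans (((Equiv.ofInjective g hg).sumCongr (Equiv.refl _)).trans
      (Equiv.Set.sumCompl (Set.range g)))
  let e : MvPolynomial ↥(Set.range g)ᶜ (MvPolynomial σ k) ≃ₐ[k] MvPolynomial τ k :=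
    (sumAlgEquiv k _ _).symm.trans (renameEquiv k e₁)
  have he : (rename g : MvPolynomial σ k →ₐ[k] MvPolynomial τ k).toRingHom =
      e.toRingEquiv.toRingHom.comp C := by
    ext i <;> simp [e, e₁]
  rw [he]
  exact RingHom.Flat.comp (RingHom.flat_algebraMap_iff.2 inferInstance)
    (.of_bijective e.bijective)

/-- The homomorphism `A[σ] → k[τ]` that maps the coefficients by `φ` and the variables by `g`. -/
noncomputable def specialize {k τ : Type*} [CommRing k] (φ : A →+* k) (g : σ → τ) :
    MvPolynomial σ A →+* MvPolynomial τ k :=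
  (rename g : MvPolynomial σ k →ₐ[k] MvPolynomial τ k).toRingHom.comp (map φ)

theorem specialize_C {k τ : Type*} [CommRing k] (φ : A →+* k) (g : σ → τ) (a : A) :
    specialize φ g (C a) = C (φ a) := by simp [specialize]

theorem specialize_X {k τ : Type*} [CommRing k] (φ : A →+* k) (g : σ → τ) (i : σ) :
    specialize φ g (X i) = X (g i) := by simp [specialize]

theorem exists_finite_generatesSyzygies_specialize [IsNoetherianRing A] [Finite σ] [Finite ι]
    (M : Matrix ι κ (MvPolynomial σ A)) :
    ∃ T : Set (κ → MvPolynomial σ A), T.Finite ∧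
      ∀ (k : Type w) [Field k] (φ : A →+* k) (n : ℕ) (g : σ → Fin n), Function.Injective g →
        GeneratesSyzygies (specialize φ g) M T := by
  obtain ⟨T, hTfin, hT⟩ := exists_generatesSyzygies_of_le_ker.{w} M ⊥
  exact ⟨T, hTfin, fun k _ φ n g hg => (hT k φ bot_le).comp_of_flat (flat_rename hg)⟩

end UniformSyzygies

/-- The full subgraph on a set of vertices. -/
def DiSubgraph.induced {V : Type} [Quiver.{0} V] (K : Set V) : DiSubgraph V where
  verts := K
  edges := {e | e.left ∈ K ∧ e.right ∈ K}
  left_mem _ h := h.1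
  right_mem _ h := h.2

theorem DiSubgraph.induced_isFullIn {V : Type} [Quiver.{0} V] {K L : Set V} (h : K ⊆ L) :
    (induced K).IsFullIn (induced L) :=
  ⟨⟨h, fun _ he => ⟨h he.1, h he.2⟩⟩, fun _ _ hl hr => ⟨hl, hr⟩⟩

/-- The vertices of a directed graph together with two apexes: `inner` for the colimit over the
subgraph induced by `K`, and `total` for the colimit over the graph and `inner`. -/
inductive TwoStep {V : Type} (K : Set V) : Type
  | base (a : V)
  | inner
  | total

namespace TwoStep

variable {V : Type} {K : Set V}

/-- The number of colimit steps after which a vertex is present. -/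
def rank : TwoStep K → ℕ
  | base _ => 0
  | inner => 1
  | total => 2

theorem rank_le_two (a : TwoStep K) : a.rank ≤ 2 := by
  cases a <;> simp [rank]

theorem rank_le_of_mem_image_base {a : TwoStep K} (ha : a ∈ base '' K) (i : ℕ) : a.rank ≤ i := by
  obtain ⟨a, -, rfl⟩ := ha
  exact Nat.zero_le i

variable [Quiver.{0} V]

/-- The edges of the graph itself, the legs of the two colimit cocones, and the leg from `inner` to
`total`. -/
inductive Hom : TwoStep K → TwoStep K → Type
  | base {a b : V} (e : a ⟶ b) : Hom (base a) (base b)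
  | innerLeg (a : V) (ha : a ∈ K) : Hom (base a) inner
  | totalLeg (a : V) : Hom (base a) total
  | innerTotal : Hom inner total

instance : Quiver.{0} (TwoStep K) := ⟨Hom⟩

/-- An edge of the graph, as an edge of the graph with the two apexes. -/
def baseEdge (K : Set V) (e : Quiver.Total V) : Quiver.Total (TwoStep K) :=
  ⟨base e.left, base e.right, Hom.base e.hom⟩

theorem edges_induced_rank_le_zero :
    (DiSubgraph.induced {a : TwoStep K | a.rank ≤ 0}).edges = Set.range (baseEdge K) := by
  refine Set.Subset.antisymm ?_ (Set.range_subset_iff.2 fun e => ⟨Nat.le_refl 0, Nat.le_refl 0⟩)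
  rintro ⟨_, _, e | _ | _ | _⟩ ⟨-, hb⟩
  · exact ⟨⟨_, _, e⟩, rfl⟩
  all_goals exact absurd hb (by simp [rank])

/-- The legs of the cocone with apex `inner`. -/
def innerLeg (a : (DiSubgraph.induced (base '' K : Set (TwoStep K))).verts) :
    a.1 ⟶ (inner : TwoStep K) :=
  match a with
  | ⟨base a, ha⟩ => Hom.innerLeg a (by simpa [DiSubgraph.induced] using ha)
  | ⟨inner, ha⟩ => absurd ha (by simp [DiSubgraph.induced])
  | ⟨total, ha⟩ => absurd ha (by simp [DiSubgraph.induced])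

/-- The legs of the cocone with apex `total`. -/
def totalLeg (a : (DiSubgraph.induced {a : TwoStep K | a.rank ≤ 1}).verts) :
    a.1 ⟶ (total : TwoStep K) :=
  match a with
  | ⟨base a, _⟩ => Hom.totalLeg a
  | ⟨inner, _⟩ => Hom.innerTotal
  | ⟨total, ha⟩ => absurd ha (by simp [DiSubgraph.induced, rank])

theorem edges_induced_rank_le_one :
    (DiSubgraph.induced {a : TwoStep K | a.rank ≤ 1}).edges =
      (DiSubgraph.induced {a : TwoStep K | a.rank ≤ 0}).edges ∪
        Set.range fun a => Quiver.Total.mk a.1 inner (innerLeg a) := by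
  refine Set.Subset.antisymm ?_ (Set.union_subset (DiSubgraph.induced_isFullIn fun a ha =>
    Nat.le_succ_of_le ha).1.2 (Set.range_subset_iff.2 fun a =>
      ⟨rank_le_of_mem_image_base a.2 1, Nat.le_refl 1⟩))
  rintro ⟨_, _, e | ⟨a, ha⟩ | _ | _⟩ ⟨-, hb⟩
  · exact Or.inl ⟨Nat.le_refl 0, Nat.le_refl 0⟩
  · exact Or.inr ⟨⟨base a, a, ha, rfl⟩, rfl⟩
  all_goals exact absurd hb (by simp [rank])

theorem edges_induced_rank_le_two :
    (DiSubgraph.induced {a : TwoStep K | a.rank ≤ 2}).edges =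
      (DiSubgraph.induced {a : TwoStep K | a.rank ≤ 1}).edges ∪
        Set.range fun a => Quiver.Total.mk a.1 total (totalLeg a) := by
  refine Set.Subset.antisymm ?_ (Set.union_subset (DiSubgraph.induced_isFullIn fun a ha =>
    Nat.le_succ_of_le ha).1.2 (Set.range_subset_iff.2 fun a => ⟨rank_le_two _, Nat.le_refl 2⟩))
  rintro ⟨_, _, e | ⟨a, ha⟩ | a | _⟩ -
  · exact Or.inl ⟨Nat.zero_le 1, Nat.zero_le 1⟩
  · exact Or.inl ⟨Nat.zero_le 1, Nat.le_refl 1⟩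
  · exact Or.inr ⟨⟨base a, Nat.zero_le 1⟩, rfl⟩
  · exact Or.inr ⟨⟨inner, Nat.le_refl 1⟩, rfl⟩

instance [Finite V] : Finite (TwoStep K) :=
  Finite.of_surjective (fun a : V ⊕ Bool => a.elim base fun i => if i then inner else total) fun
    | base a => ⟨.inl a, rfl⟩
    | inner => ⟨.inr true, rfl⟩
    | total => ⟨.inr false, rfl⟩

instance [Finite V] [Finite (Quiver.Total V)] : Finite (Quiver.Total (TwoStep K)) := by
  have hfin : (DiSubgraph.induced {a : TwoStep K | a.rank ≤ 2}).edges.Finite := by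
    rw [edges_induced_rank_le_two, edges_induced_rank_le_one, edges_induced_rank_le_zero]
    exact ((Set.finite_range _).union (Set.finite_range _)).union (Set.finite_range _)
  exact Set.finite_univ_iff.1 (hfin.subset fun e _ => ⟨rank_le_two _, rank_le_two _⟩)

variable {C : Type u} [Category.{v} C]

/-- The extension of a diagram by two objects with legs `φ` and `ψ` and a morphism between them. -/
def diagram (D : V ⥤q C) {W W' : C} (φ : ∀ a : K, D.obj a ⟶ W) (ψ : ∀ a, D.obj a ⟶ W')
    (f : W ⟶ W') : TwoStep K ⥤q C where
  obj a := match a with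
    | base a => D.obj a
    | inner => W
    | total => W'
  map e := match e with
    | .base e => D.map e
    | .innerLeg a ha => φ ⟨a, ha⟩
    | .totalLeg a => ψ a
    | .innerTotal => f

variable {D : V ⥤q C} {W W' : C} {φ : ∀ a : K, D.obj a ⟶ W} {ψ : ∀ a, D.obj a ⟶ W'} {f : W ⟶ W'}

theorem isColimitOn_inner (hφ : IsColimitOn D (DiSubgraph.induced K) W φ) :
    IsColimitOn (diagram D φ ψ f) (DiSubgraph.induced (base '' K : Set (TwoStep K))) W
      fun a => (diagram D φ ψ f).map (innerLeg a) := by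
  refine ⟨?_, fun X χ hχ => ?_⟩
  · rintro ⟨_, _, e | _ | _ | _⟩ ⟨ha, hb⟩
    · simp only [Function.Injective.mem_set_image fun _ _ => base.inj] at ha hb
      exact hφ.1 ⟨_, _, e⟩ ⟨ha, hb⟩
    all_goals simp at hb
  · obtain ⟨t, ht, huniq⟩ := hφ.2 X (fun a => χ ⟨base a.1, a.1, a.2, rfl⟩) fun e he =>
      hχ (baseEdge K e) ⟨⟨_, he.1, rfl⟩, ⟨_, he.2, rfl⟩⟩
    refine ⟨t, ?_, fun t' ht' => huniq t' fun a => ht' ⟨base a.1, a.1, a.2, rfl⟩⟩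
    rintro ⟨_, a, ha, rfl⟩
    exact ht ⟨a, ha⟩

theorem isColimitOn_total (hφ : IsColimitOn D (DiSubgraph.induced K) W φ)
    (hψ : IsColimitOn D (DiSubgraph.induced Set.univ) W' fun a => ψ a.1)
    (hf : ∀ a, φ a ≫ f = ψ a.1) :
    IsColimitOn (diagram D φ ψ f) (DiSubgraph.induced {a : TwoStep K | a.rank ≤ 1}) W'
      fun a => (diagram D φ ψ f).map (totalLeg a) := by
  refine ⟨?_, fun X χ hχ => ?_⟩
  · rintro ⟨_, _, e | ⟨a, ha⟩ | _ | _⟩ ⟨-, hb⟩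
    · exact hψ.1 ⟨_, _, e⟩ ⟨trivial, trivial⟩
    · exact hf ⟨a, ha⟩
    all_goals exact absurd hb (by simp [rank])
  · obtain ⟨t, ht, huniq⟩ := hψ.2 X (fun a => χ ⟨base a.1, Nat.zero_le 1⟩) fun e _ =>
      hχ (baseEdge K e) ⟨Nat.zero_le 1, Nat.zero_le 1⟩
    refine ⟨t, ?_, fun t' ht' => huniq t' fun a => ht' ⟨base a.1, Nat.zero_le 1⟩⟩
    rintro ⟨a | _ | _, ha⟩
    · exact ht ⟨a, trivial⟩
    · refine (hφ.2 X (fun a => χ ⟨base a.1, Nat.zero_le 1⟩) fun e _ =>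
        hχ (baseEdge K e) ⟨Nat.zero_le 1, Nat.zero_le 1⟩).unique (fun a => ?_) fun a => ?_
      · have hft : (φ a ≫ f) ≫ t = χ ⟨base a.1, Nat.zero_le 1⟩ :=
          (congrArg (· ≫ t) (hf a)).trans (ht ⟨a.1, trivial⟩)
        exact (Category.assoc _ _ _).symm.trans hft
      · exact hχ ⟨_, _, Hom.innerLeg a.1 a.2⟩ ⟨Nat.zero_le 1, Nat.le_refl 1⟩
    · exact absurd ha (by simp [DiSubgraph.induced, rank])

/-- The computation that first adds the colimit over the subgraph induced by `K` and then the
colimit over everything. -/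
def computation [Finite V] [Finite (Quiver.Total V)] {A : MorphismProperty C}
    (hA : ∀ {a b : V} (e : a ⟶ b), A (D.map e))
    (hV : ∀ a, ∃ e : Quiver.Total V, e.left = a ∨ e.right = a)
    (hφ : IsColimitOn D (DiSubgraph.induced K) W φ)
    (hψ : IsColimitOn D (DiSubgraph.induced Set.univ) W' fun a => ψ a.1)
    (hf : ∀ a, φ a ≫ f = ψ a.1) : ColimitComputation A where
  V := TwoStep K
  diagram := diagram D φ ψ f
  steps := 2
  shape i := DiSubgraph.induced {a | a.rank ≤ i}
  shape_last_verts := Set.eq_univ_of_forall rank_le_two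
  shape_last_edges := Set.eq_univ_of_forall fun _ => ⟨rank_le_two _, rank_le_two _⟩
  basic e he := by
    obtain ⟨e, rfl⟩ := edges_induced_rank_le_zero.le he
    exact hA e.hom
  no_isolated
    | base a, _ => (hV a).elim fun e he =>
        ⟨baseEdge K e, ⟨Nat.le_refl 0, Nat.le_refl 0⟩, he.imp (congrArg base) (congrArg base)⟩
    | inner, ha => absurd ha (by simp [DiSubgraph.induced, rank])
    | total, ha => absurd ha (by simp [DiSubgraph.induced, rank])
  sub
    | 0 => DiSubgraph.induced (base '' K)
    | 1 => DiSubgraph.induced {a | a.rank ≤ 1}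
  sub_full
    | 0 => DiSubgraph.induced_isFullIn fun _ ha => rank_le_of_mem_image_base ha 0
    | 1 => DiSubgraph.induced_isFullIn subset_rfl
  apex
    | 0 => inner
    | 1 => total
  apex_new
    | 0 => Nat.not_succ_le_self 0
    | 1 => Nat.not_succ_le_self 1
  leg
    | 0 => innerLeg
    | 1 => totalLeg
  verts_succ
    | 0 => by ext (_ | _ | _) <;> simp [DiSubgraph.induced, rank]
    | 1 => by ext (_ | _ | _) <;> simp [DiSubgraph.induced, rank]
  edges_succ
    | 0 => edges_induced_rank_le_one
    | 1 => edges_induced_rank_le_two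
  isColimit
    | 0 => isColimitOn_inner hφ
    | 1 => isColimitOn_total hφ hψ hf
  constructive
    | 0, 1 => fun _ _ =>
      (DiSubgraph.induced_isFullIn fun _ ha => rank_le_of_mem_image_base ha 1).1
    | 0, 0 | 1, 0 | 1, 1 => fun h => absurd h (by decide)

theorem exists_computes [Finite V] [Finite (Quiver.Total V)] {A : MorphismProperty C}
    (hA : ∀ {a b : V} (e : a ⟶ b), A (D.map e))
    (hV : ∀ a, ∃ e : Quiver.Total V, e.left = a ∨ e.right = a)
    (hφ : IsColimitOn D (DiSubgraph.induced K) W φ)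
    (hψ : IsColimitOn D (DiSubgraph.induced Set.univ) W' fun a => ψ a.1)
    (hf : ∀ a, φ a ≫ f = ψ a.1) :
    ∃ Q : ColimitComputation A, Q.Computes (morphismDiagram f) ∧
      Q.size ≤ 2 + Nat.card (Quiver.Total V) := by
  refine ⟨computation (@hA) hV hφ hψ hf, ?_, ?_⟩
  · let g : ArrowGraph ⥤q TwoStep K :=
      { obj := fun
          | .source => inner
          | .target => total
        map := fun
          | .edge => Hom.innerTotal }
    refine ⟨g, ?_, fun _ _ => ?_, fun
      | .source => Iso.refl _
      | .target => Iso.refl _, ?_⟩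
    · rintro (_ | _) (_ | _) h
      · rfl
      · exact absurd h (by simp [g])
      · exact absurd h (by simp [g])
      · rfl
    · rintro ⟨⟩ ⟨⟩ _
      rfl
    · rintro _ _ ⟨⟩
      exact (Category.comp_id _).trans (Category.id_comp _).symm
  · refine Nat.add_le_add_left ?_ 2
    change (DiSubgraph.induced {a : TwoStep K | a.rank ≤ 0}).edges.ncard ≤ _
    rw [edges_induced_rank_le_zero]
    exact Finite.card_range_le _

end TwoStep

section Presentation

variable {R N N' ι κ μ : Type*} [CommRing R] [AddCommGroup N] [Module R N] [AddCommGroup N']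
  [Module R N'] [Fintype ι]

/-- `x` and `Z` are generators and relations of the module `N`: the family `x` generates `N`, and
the vectors in `Z` generate the relations between its members. -/
structure IsPresentation (x : ι → N) (Z : Set (ι → R)) : Prop where
  span_range_eq_top : Submodule.span R (Set.range x) = ⊤
  ker_eq_span : LinearMap.ker (Fintype.linearCombination R x) = Submodule.span R Z

namespace IsPresentation

variable {x : ι → N} {Z Z' : Set (ι → R)}

theorem sum_smul_eq_zero (h : IsPresentation x Z) {z : ι → R} (hz : z ∈ Z) :
    ∑ i, z i • x i = 0 :=
  h.ker_eq_span.ge (Submodule.subset_span hz)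

theorem of_superset (h : IsPresentation x Z) (hZ : Z ⊆ Z') (hZ' : ∀ z ∈ Z', ∑ i, z i • x i = 0) :
    IsPresentation x Z' :=
  ⟨h.span_range_eq_top, (h.ker_eq_span.trans_le (Submodule.span_mono hZ)).antisymm
    (Submodule.span_le.2 hZ')⟩

theorem existsUnique_linearMap (h : IsPresentation x Z) {x' : ι → N'}
    (hx' : ∀ z ∈ Z, ∑ i, z i • x' i = 0) : ∃! t : N →ₗ[R] N', ∀ i, t (x i) = x' i := by
  classical
  have hsurj : Function.Surjective (Fintype.linearCombination R x) := by
    rw [← LinearMap.range_eq_top, Fintype.range_linearCombination, h.span_range_eq_top]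
  have hker : LinearMap.ker (Fintype.linearCombination R x) ≤
      LinearMap.ker (Fintype.linearCombination R x') :=
    h.ker_eq_span.trans_le (Submodule.span_le.2 hx')
  refine ⟨(Submodule.liftQ _ _ hker).comp
    ((Fintype.linearCombination R x).quotKerEquivOfSurjective hsurj).symm.toLinearMap,
    fun i => ?_, fun t ht => LinearMap.ext_on h.span_range_eq_top ?_⟩
  · have hi : x i = Fintype.linearCombination R x (Pi.single i 1) := by simp
    rw [hi, LinearMap.comp_apply, LinearEquiv.coe_coe,
      LinearMap.quotKerEquivOfSurjective_symm_apply, Submodule.liftQ_apply,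
      Fintype.linearCombination_apply_single, one_smul]
  · rintro _ ⟨i, rfl⟩
    have hi : x i = Fintype.linearCombination R x (Pi.single i 1) := by simp
    rw [ht, hi, LinearMap.comp_apply, LinearEquiv.coe_coe,
      LinearMap.quotKerEquivOfSurjective_symm_apply, Submodule.liftQ_apply,
      Fintype.linearCombination_apply_single, one_smul]

theorem sumElim [Fintype κ] [DecidableEq κ] (h : IsPresentation x Z) {y : κ → N} {B : κ → ι → R}
    (hy : ∀ j, y j = ∑ i, B j i • x i) :
    IsPresentation (Sum.elim y x)
      (Set.range (fun j => Sum.elim (Pi.single j 1) (-B j)) ∪ Sum.elim 0 '' Z) := by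
  refine ⟨top_unique (h.span_range_eq_top.ge.trans (Submodule.span_mono ?_)),
    le_antisymm (fun v hv => ?_) (Submodule.span_le.2 (Set.union_subset ?_ ?_))⟩
  · rintro _ ⟨i, rfl⟩
    exact ⟨.inr i, rfl⟩
  · let w : ι → R := v ∘ Sum.inr + ∑ j, v (Sum.inl j) • B j
    have hw : w ∈ LinearMap.ker (Fintype.linearCombination R x) := by
      rw [LinearMap.mem_ker, ← LinearMap.mem_ker.1 hv]
      simp only [w, map_add, map_sum, map_smul, Fintype.linearCombination_apply,
        Fintype.sum_sum_type, Sum.elim_inl, Sum.elim_inr, hy, Function.comp_apply]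
      exact add_comm _ _
    have hvw : v = ∑ j, v (Sum.inl j) • Sum.elim (Pi.single j 1) (-B j) +
        Sum.elim (0 : κ → R) w := by
      ext (j | i) <;> simp [w, Finset.sum_apply, Pi.single_apply]
    rw [hvw]
    refine Submodule.add_mem _ (Submodule.sum_mem _ fun j _ => Submodule.smul_mem _ _
      (Submodule.subset_span (Or.inl ⟨j, rfl⟩))) ?_
    let g : (ι → R) →ₗ[R] (κ ⊕ ι → R) :=
      (LinearEquiv.sumArrowLequivProdArrow κ ι R R).symm ∘ₗ LinearMap.inr R (κ → R) (ι → R)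
    have hg : Submodule.span R Z ≤ (Submodule.span R (Sum.elim (0 : κ → R) '' Z)).comap g :=
      Submodule.span_le.2 fun z hz => Submodule.subset_span ⟨z, hz, rfl⟩
    exact Submodule.span_mono Set.subset_union_right (hg (h.ker_eq_span.le hw))
  · rintro _ ⟨j, rfl⟩
    simp [hy, Fintype.linearCombination_apply, Pi.single_apply]
  · rintro _ ⟨z, hz, rfl⟩
    simpa [Fintype.linearCombination_apply] using h.sum_smul_eq_zero hz

theorem linearCombination_mulVec [Fintype κ] [Fintype μ] {M : Matrix ι (κ ⊕ μ) R}
    (h : IsPresentation x (Set.range fun r i => M i (Sum.inr r))) (w : κ ⊕ μ → R) :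
    Fintype.linearCombination R x (M.mulVec w) =
      ∑ j, w (Sum.inl j) • ∑ i, M i (Sum.inl j) • x i := by
  have hcol (r : μ) : ∑ i, M i (Sum.inr r) • x i = 0 := h.sum_smul_eq_zero ⟨r, rfl⟩
  calc ∑ i, M.mulVec w i • x i = ∑ g, w g • ∑ i, M i g • x i := by
        simp only [Matrix.mulVec, dotProduct, Finset.sum_smul, Finset.smul_sum, smul_smul, mul_comm]
        exact Finset.sum_comm
    _ = ∑ j, w (Sum.inl j) • ∑ i, M i (Sum.inl j) • x i := by
        simp only [Fintype.sum_sum_type, hcol, smul_zero, Finset.sum_const_zero, add_zero]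

theorem restrict [Fintype κ] [Fintype μ] {M : Matrix ι (κ ⊕ μ) R} {T : Set (κ ⊕ μ → R)}
    {L : Submodule R N} {y : κ → L} (h : IsPresentation x (Set.range fun r i => M i (Sum.inr r)))
    (hy : ∀ j, (y j : N) = ∑ i, M i (Sum.inl j) • x i)
    (hL : Submodule.span R (Set.range fun j => (y j : N)) = L)
    (hT : LinearMap.ker M.mulVecLin = Submodule.span R T) :
    IsPresentation y ((· ∘ Sum.inl) '' T) := by
  have hcomb (w : κ ⊕ μ → R) : Fintype.linearCombination R x (M.mulVec w) =
      Fintype.linearCombination R y (w ∘ Sum.inl) := by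
    simp [h.linearCombination_mulVec, ← hy, Fintype.linearCombination_apply]
  refine ⟨Submodule.map_injective_of_injective L.injective_subtype ?_, le_antisymm ?_ ?_⟩
  · rw [Submodule.map_span, ← Set.range_comp, Submodule.map_subtype_top]
    exact hL
  · intro v hv
    have hu : M.mulVec (Sum.elim v 0) ∈
        Submodule.span R (Set.range fun r i => M i (Sum.inr r)) := by
      rw [← h.ker_eq_span, LinearMap.mem_ker, hcomb]
      exact congrArg Subtype.val hv
    obtain ⟨u, hu⟩ := (Submodule.mem_span_range_iff_exists_fun R).1 hu
    have hvu : Sum.elim v (-u) ∈ Submodule.span R T := by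
      rw [← hT, LinearMap.mem_ker, Matrix.mulVecLin_apply]
      ext i
      have hi := congrFun hu i
      simp only [Finset.sum_apply, Pi.smul_apply, smul_eq_mul, Matrix.mulVec, dotProduct,
        Fintype.sum_sum_type, Sum.elim_inl, Sum.elim_inr, Pi.zero_apply, mul_zero,
        Finset.sum_const_zero, add_zero] at hi
      simp only [Matrix.mulVec, dotProduct, Fintype.sum_sum_type, Sum.elim_inl, Sum.elim_inr,
        Pi.neg_apply, mul_neg, Finset.sum_neg_distrib, ← hi, mul_comm (u _), add_neg_cancel,
        Pi.zero_apply]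
    have hmap := Submodule.mem_map_of_mem (f := LinearMap.funLeft R R (Sum.inl : κ → κ ⊕ μ)) hvu
    rwa [Submodule.map_span] at hmap
  · rw [Submodule.span_le]
    rintro _ ⟨t, ht, rfl⟩
    have h0 : M.mulVec t = 0 := hT.ge (Submodule.subset_span ht)
    refine Subtype.ext ((hcomb t).symm.trans ?_)
    rw [h0, map_zero]
    rfl

end IsPresentation

theorem isPresentation_of_existsUnique {R : Type w} {N : Type w} {ι : Type} [Fintype ι]
    [CommRing R] [AddCommGroup N] [Module R N] {x : ι → N} {Z : Set (ι → R)}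
    (hx : ∀ z ∈ Z, ∑ i, z i • x i = 0)
    (h : ∀ (X : Type w) [AddCommGroup X] [Module R X] (x' : ι → X),
      (∀ z ∈ Z, ∑ i, z i • x' i = 0) → ∃! t : N →ₗ[R] X, ∀ i, t (x i) = x' i) :
    IsPresentation x Z := by
  classical
  refine ⟨?_, le_antisymm (fun v hv => ?_) (Submodule.span_le.2 hx)⟩
  · rw [← Submodule.ker_mkQ (Submodule.span R (Set.range x)), LinearMap.ker_eq_top]
    refine (h (N ⧸ Submodule.span R (Set.range x)) 0 (by simp)).unique (fun i => ?_) (by simp)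
    exact (Submodule.Quotient.mk_eq_zero _).2 (Submodule.subset_span ⟨i, rfl⟩)
  · have hmk (v : ι → R) : ∑ i, v i • (Submodule.span R Z).mkQ (Pi.single i 1) =
        (Submodule.span R Z).mkQ v := by
      simp_rw [← map_smul, ← map_sum]
      rw [← pi_eq_sum_univ' v]
    obtain ⟨t, ht, -⟩ := h ((ι → R) ⧸ Submodule.span R Z)
      (fun i => (Submodule.span R Z).mkQ (Pi.single i 1))
      fun z hz => (hmk z).trans ((Submodule.Quotient.mk_eq_zero _).2 (Submodule.subset_span hz))
    rw [← Submodule.Quotient.mk_eq_zero (Submodule.span R Z), ← Submodule.mkQ_apply, ← hmk]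
    simp_rw [← ht, ← map_smul, ← map_sum]
    rw [show ∑ i, v i • x i = 0 from hv, map_zero]

end Presentation

/-- A system of linear equations of two kinds between finitely many unknowns `U`: the gates `E`
impose `y (src e) = coef e • y (tgt e)`, and the gates `G` impose
`y (sum g) = y (left g) + y (right g)`. Every unknown is the source of a gate. -/
structure GateSystem (R : Type w) where
  /-- the unknowns -/
  U : Type
  /-- the scalar gates -/
  E : Type
  /-- the addition gates -/
  G : Type
  [finite_U : Finite U]
  [finite_E : Finite E]
  [finite_G : Finite G]
  src : E → U
  tgt : E → U
  coef : E → R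
  sum : G → U
  left : G → U
  right : G → U
  exists_src : ∀ u, ∃ e, src e = u

namespace GateSystem

attribute [instance] finite_U finite_E finite_G

variable {R : Type w} (S : GateSystem R)

/-- The graph of a system of gates: one vertex for each unknown, where `R` will be placed, and one
vertex for each addition gate, where `R × R` will be placed. -/
inductive Vert : Type
  | scalar (u : S.U)
  | pair (g : S.G)

/-- The edges of the graph of a system of gates, each named after the map it will carry. -/
inductive Hom : S.Vert → S.Vert → Type
  | mul (e : S.E) : Hom (.scalar (S.src e)) (.scalar (S.tgt e))
  | inl (g : S.G) : Hom (.scalar (S.left g)) (.pair g)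
  | inr (g : S.G) : Hom (.scalar (S.right g)) (.pair g)
  | diag (g : S.G) : Hom (.scalar (S.sum g)) (.pair g)

instance : Quiver.{0} S.Vert := ⟨S.Hom⟩

instance : Finite S.Vert :=
  Finite.of_surjective (Sum.elim Vert.scalar Vert.pair) fun
    | .scalar u => ⟨.inl u, rfl⟩
    | .pair g => ⟨.inr g, rfl⟩

/-- The enumeration of the edges of the graph of a system of gates. -/
def edge : S.E ⊕ S.G ⊕ S.G ⊕ S.G → Quiver.Total S.Vert
  | .inl e => ⟨_, _, Hom.mul e⟩
  | .inr (.inl g) => ⟨_, _, Hom.inl g⟩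
  | .inr (.inr (.inl g)) => ⟨_, _, Hom.inr g⟩
  | .inr (.inr (.inr g)) => ⟨_, _, Hom.diag g⟩

theorem edge_surjective : Function.Surjective S.edge := fun
  | ⟨_, _, .mul e⟩ => ⟨.inl e, rfl⟩
  | ⟨_, _, .inl g⟩ => ⟨.inr (.inl g), rfl⟩
  | ⟨_, _, .inr g⟩ => ⟨.inr (.inr (.inl g)), rfl⟩
  | ⟨_, _, .diag g⟩ => ⟨.inr (.inr (.inr g)), rfl⟩

instance : Finite (Quiver.Total S.Vert) := Finite.of_surjective _ S.edge_surjective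

theorem card_total_le : Nat.card (Quiver.Total S.Vert) ≤ Nat.card S.E + 3 * Nat.card S.G := by
  refine (Nat.card_le_card_of_surjective _ S.edge_surjective).trans_eq ?_
  rw [Nat.card_sum, Nat.card_sum, Nat.card_sum]
  ring

/-- The vertices that only involve unknowns in `K`. -/
def vertsOver (K : Set S.U) : Set S.Vert
  | .scalar u => u ∈ K
  | .pair g => S.sum g ∈ K ∧ S.left g ∈ K ∧ S.right g ∈ K

theorem vertsOver_univ : S.vertsOver Set.univ = Set.univ :=
  Set.eq_univ_of_forall fun
    | .scalar _ => trivial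
    | .pair _ => ⟨trivial, trivial, trivial⟩

variable [CommRing R]

/-- The assignment `y` satisfies the gates with all unknowns in `K`. -/
def IsSolution (K : Set S.U) {X : Type*} [AddCommGroup X] [Module R X] (y : S.U → X) : Prop :=
  (∀ e, S.src e ∈ K → S.tgt e ∈ K → y (S.src e) = S.coef e • y (S.tgt e)) ∧
    ∀ g, S.sum g ∈ K → S.left g ∈ K → S.right g ∈ K → y (S.sum g) = y (S.left g) + y (S.right g)

/-- The assignment `y` is universal among those that satisfy the gates with all unknowns in `K`.
Its values outside `K` are irrelevant. -/
def IsUniversal (K : Set S.U) {W : Type w} [AddCommGroup W] [Module R W] (y : S.U → W) : Prop :=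
  S.IsSolution K y ∧ ∀ (X : Type w) [AddCommGroup X] [Module R X] (x : S.U → X),
    S.IsSolution K x → ∃! t : W →ₗ[R] X, ∀ u ∈ K, t (y u) = x u

/-- The diagram of free modules whose cocones are the solutions of a system of gates. -/
def diagram : S.Vert ⥤q ModuleCat.{w} R where
  obj
    | .scalar _ => ModuleCat.of R R
    | .pair _ => ModuleCat.of R (R × R)
  map
    | .mul e => ModuleCat.ofHom (LinearMap.lsmul R R (S.coef e))
    | .inl _ => ModuleCat.ofHom (LinearMap.inl R R R)
    | .inr _ => ModuleCat.ofHom (LinearMap.inr R R R)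
    | .diag _ => ModuleCat.ofHom (LinearMap.prod LinearMap.id LinearMap.id)

/-- The cocone attached to an assignment. -/
def leg {X : ModuleCat.{w} R} (y : S.U → X) : ∀ v : S.Vert, S.diagram.obj v ⟶ X
  | .scalar u => ModuleCat.ofHom (LinearMap.toSpanSingleton R X (y u))
  | .pair g => ModuleCat.ofHom ((LinearMap.toSpanSingleton R X (y (S.left g))).coprod
      (LinearMap.toSpanSingleton R X (y (S.right g))))

variable {S} {K : Set S.U} {X Y : ModuleCat.{w} R}

theorem hom_eq_iff_scalar {u : S.U} {f f' : S.diagram.obj (.scalar u) ⟶ X} :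
    f = f' ↔ f.hom (1 : R) = f'.hom (1 : R) :=
  ⟨fun h => h ▸ rfl, fun h => ModuleCat.hom_ext (LinearMap.ext_ring h)⟩

theorem hom_ext_pair {g : S.G} {f f' : S.diagram.obj (.pair g) ⟶ X}
    (hl : f.hom ((1, 0) : R × R) = f'.hom ((1, 0) : R × R))
    (hr : f.hom ((0, 1) : R × R) = f'.hom ((0, 1) : R × R)) : f = f' :=
  ModuleCat.hom_ext (LinearMap.prod_ext (LinearMap.ext_ring hl) (LinearMap.ext_ring hr))

theorem leg_scalar_apply (y : S.U → X) (u : S.U) (r : R) :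
    (S.leg y (.scalar u)).hom r = r • y u := rfl

theorem leg_pair_apply (y : S.U → X) (g : S.G) (r r' : R) :
    (S.leg y (.pair g)).hom (r, r') = r • y (S.left g) + r' • y (S.right g) := rfl

theorem leg_comp (y : S.U → X) (t : X ⟶ Y) : ∀ v, S.leg y v ≫ t = S.leg (t.hom ∘ y) v
  | .scalar _ => hom_eq_iff_scalar.2 (map_smul t.hom _ _)
  | .pair _ =>
    have h (r r' : R) (x x' : X) : t.hom (r • x + r' • x') = r • t.hom x + r' • t.hom x' := by
      rw [map_add, map_smul, map_smul]
    hom_ext_pair (h _ _ _ _) (h _ _ _ _)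

theorem forall_leg_eq_iff {y y' : S.U → X} :
    (∀ v ∈ S.vertsOver K, S.leg y v = S.leg y' v) ↔ ∀ u ∈ K, y u = y' u := by
  refine ⟨fun h u hu => ?_, ?_⟩
  · have hu := congrArg (fun t => t.hom (1 : R)) (h (.scalar u) hu)
    simpa only [leg_scalar_apply, one_smul] using hu
  · rintro h (u | g) hv
    · exact hom_eq_iff_scalar.2 (congrArg ((1 : R) • ·) (h u hv))
    · refine hom_ext_pair ?_ ?_ <;>
        rw [leg_pair_apply, leg_pair_apply, h _ hv.2.1, h _ hv.2.2]

theorem isCoconeOn_leg_iff {y : S.U → X} :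
    IsCoconeOn S.diagram (DiSubgraph.induced (S.vertsOver K)) X (fun a => S.leg y a.1) ↔
      S.IsSolution K y := by
  have hmul (e : S.E) : S.diagram.map (Hom.mul e) ≫ S.leg y (.scalar (S.tgt e)) =
      S.leg y (.scalar (S.src e)) ↔ y (S.src e) = S.coef e • y (S.tgt e) := by
    refine hom_eq_iff_scalar.trans ?_
    change (S.coef e * 1) • y (S.tgt e) = (1 : R) • y (S.src e) ↔ _
    rw [mul_one, one_smul, eq_comm]
  have hdiag (g : S.G) : S.diagram.map (Hom.diag g) ≫ S.leg y (.pair g) =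
      S.leg y (.scalar (S.sum g)) ↔ y (S.sum g) = y (S.left g) + y (S.right g) := by
    refine hom_eq_iff_scalar.trans ?_
    change (1 : R) • y (S.left g) + (1 : R) • y (S.right g) = (1 : R) • y (S.sum g) ↔ _
    rw [one_smul, one_smul, one_smul, eq_comm]
  refine ⟨fun h => ⟨fun e hs ht => (hmul e).1 (h ⟨_, _, Hom.mul e⟩ ⟨hs, ht⟩),
    fun g hs hl hr => (hdiag g).1 (h ⟨_, _, Hom.diag g⟩ ⟨hs, hs, hl, hr⟩)⟩, fun h => ?_⟩
  rintro ⟨_, _, e | g | g | g⟩ ⟨ha, hb⟩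
  · exact (hmul e).2 (h.1 e ha hb)
  · refine hom_eq_iff_scalar.2 ?_
    change (1 : R) • y (S.left g) + (0 : R) • y (S.right g) = (1 : R) • y (S.left g)
    rw [zero_smul, add_zero]
  · refine hom_eq_iff_scalar.2 ?_
    change (0 : R) • y (S.left g) + (1 : R) • y (S.right g) = (1 : R) • y (S.right g)
    rw [zero_smul, zero_add]
  · exact (hdiag g).2 (h.2 g hb.1 hb.2.1 hb.2.2)

theorem exists_eq_leg_of_isCoconeOn
    {χ : ∀ a : (DiSubgraph.induced (S.vertsOver K)).verts, S.diagram.obj a.1 ⟶ X}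
    (hχ : IsCoconeOn S.diagram (DiSubgraph.induced (S.vertsOver K)) X χ) :
    ∃ y : S.U → X, ∀ a, χ a = S.leg y a.1 := by
  classical
  let y (u : S.U) : X := if hu : u ∈ K then (χ ⟨.scalar u, hu⟩).hom (1 : R) else 0
  have hy {u : S.U} (hu : u ∈ K) : (χ ⟨.scalar u, hu⟩).hom (1 : R) = y u := by
    simp only [y, dif_pos hu]
  refine ⟨y, ?_⟩
  rintro ⟨u | g, ha⟩
  · exact hom_eq_iff_scalar.2 ((hy ha).trans (one_smul R _).symm)
  · have hl := congrArg (fun t => t.hom (1 : R)) (hχ ⟨_, _, Hom.inl g⟩ ⟨ha.2.1, ha⟩)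
    have hr := congrArg (fun t => t.hom (1 : R)) (hχ ⟨_, _, Hom.inr g⟩ ⟨ha.2.2, ha⟩)
    refine hom_ext_pair ((hl.trans (hy ha.2.1)).trans ?_) ((hr.trans (hy ha.2.2)).trans ?_)
    · rw [leg_pair_apply, one_smul, zero_smul, add_zero]
    · rw [leg_pair_apply, one_smul, zero_smul, zero_add]

theorem IsUniversal.isColimitOn_leg {y : S.U → X} (hy : S.IsUniversal K y) :
    IsColimitOn S.diagram (DiSubgraph.induced (S.vertsOver K)) X (fun a => S.leg y a.1) := by
  refine ⟨isCoconeOn_leg_iff.2 hy.1, fun Y χ hχ => ?_⟩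
  obtain ⟨x, hx⟩ := exists_eq_leg_of_isCoconeOn hχ
  obtain rfl : χ = fun a : (DiSubgraph.induced (S.vertsOver K)).verts => S.leg x a.1 := funext hx
  have hiff (t : X ⟶ Y) : (∀ a : (DiSubgraph.induced (S.vertsOver K)).verts,
      S.leg y a.1 ≫ t = S.leg x a.1) ↔ ∀ u ∈ K, t.hom (y u) = x u := by
    simp only [leg_comp]
    exact Subtype.forall.trans forall_leg_eq_iff
  obtain ⟨t, ht, huniq⟩ := hy.2 Y x (isCoconeOn_leg_iff.1 hχ)
  exact ⟨ModuleCat.ofHom t, (hiff _).2 ht, fun t' ht' =>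
    ModuleCat.hom_ext (huniq t'.hom ((hiff t').1 ht'))⟩

theorem exists_computes {A : MorphismProperty (ModuleCat.{w} R)}
    (hmul : ∀ e, A (ModuleCat.ofHom (LinearMap.lsmul R R (S.coef e))))
    (hinl : A (ModuleCat.ofHom (LinearMap.inl R R R)))
    (hinr : A (ModuleCat.ofHom (LinearMap.inr R R R)))
    (hdiag : A (ModuleCat.ofHom (LinearMap.prod (LinearMap.id : R →ₗ[R] R) LinearMap.id)))
    {y : S.U → X} (hy : S.IsUniversal K y) {y' : S.U → Y} (hy' : S.IsUniversal Set.univ y')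
    {f : X ⟶ Y} (hf : ∀ u ∈ K, f (y u) = y' u) :
    ∃ Q : ColimitComputation A, Q.Computes (morphismDiagram f) ∧
      Q.size ≤ 2 + (Nat.card S.E + 3 * Nat.card S.G) := by
  have hA {a b : S.Vert} (e : a ⟶ b) : A (S.diagram.map e) := by
    rcases e with e | g | g | g
    exacts [hmul e, hinl, hinr, hdiag]
  obtain ⟨Q, hQ, hsize⟩ := TwoStep.exists_computes (A := A) (f := f) (@hA)
    (fun
      | .scalar u => (S.exists_src u).elim fun e he =>
          ⟨⟨_, _, Hom.mul e⟩, Or.inl (congrArg Vert.scalar he)⟩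
      | .pair g => ⟨⟨_, _, Hom.inl g⟩, Or.inr rfl⟩)
    hy.isColimitOn_leg (S.vertsOver_univ ▸ hy'.isColimitOn_leg)
    (fun a => (leg_comp y f a.1).trans (forall_leg_eq_iff.2 hf a.1 a.2))
  exact ⟨Q, hQ, hsize.trans (Nat.add_le_add_left S.card_total_le 2)⟩

end GateSystem

/-- Formal linear terms in generators `γ` with scalars `κ`: straight-line programs that evaluate a
linear combination by multiplications by scalars and additions. -/
inductive LinearTerm (γ κ : Type) : Type
  | gen (g : γ)
  | zero
  | smul (i : κ) (t : LinearTerm γ κ)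
  | add (s t : LinearTerm γ κ)

namespace LinearTerm

section Subterms

variable {γ κ : Type}

/-- All generators that occur in the term lie in `K`. -/
def UsesOnly (K : Set γ) : LinearTerm γ κ → Prop
  | gen g => g ∈ K
  | zero => True
  | smul _ t => UsesOnly K t
  | add s t => UsesOnly K s ∧ UsesOnly K t

theorem UsesOnly.mono {K L : Set γ} (h : K ⊆ L) {t : LinearTerm γ κ} (ht : t.UsesOnly K) :
    t.UsesOnly L := by
  induction t with
  | gen g => exact h ht
  | zero => trivial
  | smul i t ih => exact ih ht
  | add s t hs ht' => exact ⟨hs ht.1, ht' ht.2⟩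

theorem usesOnly_univ (t : LinearTerm γ κ) : t.UsesOnly Set.univ := by
  induction t with
  | gen | zero => trivial
  | smul _ _ ih => exact ih
  | add _ _ hs ht => exact ⟨hs, ht⟩

/-- The subterms of a term, including the term itself. -/
def subterms : LinearTerm γ κ → Set (LinearTerm γ κ)
  | gen g => {gen g}
  | zero => {zero}
  | smul i t => insert (smul i t) (subterms t)
  | add s t => insert (add s t) (subterms s ∪ subterms t)

/-- A set of terms that contains the subterms of its elements. -/
def IsSubtermClosed (s : Set (LinearTerm γ κ)) : Prop :=
  (∀ i t, smul i t ∈ s → t ∈ s) ∧ ∀ a b, add a b ∈ s → a ∈ s ∧ b ∈ s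

theorem finite_subterms : ∀ t : LinearTerm γ κ, t.subterms.Finite
  | gen _ => Set.finite_singleton _
  | zero => Set.finite_singleton _
  | smul _ t => (finite_subterms t).insert _
  | add s t => ((finite_subterms s).union (finite_subterms t)).insert _

theorem self_mem_subterms (t : LinearTerm γ κ) : t ∈ t.subterms := by
  cases t <;> simp [subterms]

theorem isSubtermClosed_subterms (t : LinearTerm γ κ) : IsSubtermClosed t.subterms := by
  induction t with
  | gen | zero => constructor <;> simp [subterms]
  | smul i t ih =>
    refine ⟨fun j r h => h.elim (fun h => ?_) fun h => .inr (ih.1 j r h),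
      fun a b h => h.elim nofun fun h => (ih.2 a b h).imp .inr .inr⟩
    cases h
    exact .inr (self_mem_subterms t)
  | add s t hs ht =>
    refine ⟨fun j r h => .inr (h.elim nofun fun h => h.imp (hs.1 j r) (ht.1 j r)), fun a b h => ?_⟩
    rcases h with h | h | h
    · cases h
      exact ⟨.inr (.inl (self_mem_subterms s)), .inr (.inr (self_mem_subterms t))⟩
    · exact (hs.2 a b h).imp (.inr ∘ .inl) (.inr ∘ .inl)
    · exact (ht.2 a b h).imp (.inr ∘ .inr) (.inr ∘ .inr)

theorem exists_finite_isSubtermClosed {s : Set (LinearTerm γ κ)} (hs : s.Finite) :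
    ∃ s' : Set (LinearTerm γ κ), s ⊆ s' ∧ s'.Finite ∧ IsSubtermClosed s' := by
  refine ⟨⋃ t ∈ s, subterms t, fun t ht => Set.mem_biUnion ht (self_mem_subterms t),
    hs.biUnion fun t _ => finite_subterms t, fun i t h => ?_, fun a b h => ?_⟩
  all_goals obtain ⟨r, hr, h⟩ := Set.mem_iUnion₂.1 h
  · exact Set.mem_biUnion hr ((isSubtermClosed_subterms r).1 i t h)
  · exact ((isSubtermClosed_subterms r).2 a b h).imp (Set.mem_biUnion hr) (Set.mem_biUnion hr)

end Subterms

section Eval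

variable {γ κ : Type} {R X Y : Type*} [CommRing R] [AddCommGroup X] [Module R X] [AddCommGroup Y]
  [Module R Y]

/-- The value of a term once its scalars and its generators are interpreted. -/
def eval (ρ : κ → R) (x : γ → X) : LinearTerm γ κ → X
  | gen g => x g
  | zero => 0
  | smul i t => ρ i • eval ρ x t
  | add s t => eval ρ x s + eval ρ x t

theorem map_eval (ρ : κ → R) (f : X →ₗ[R] Y) {K : Set γ} {x : γ → X} {y : γ → Y}
    (h : ∀ g ∈ K, f (x g) = y g) {t : LinearTerm γ κ} (ht : t.UsesOnly K) :
    f (t.eval ρ x) = t.eval ρ y := by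
  induction t with
  | gen g => exact h g ht
  | zero => exact map_zero f
  | smul i t ih => simp only [eval, map_smul, ih ht]
  | add s t hs ht' => simp only [eval, map_add, hs ht.1, ht' ht.2]

end Eval

section Coeff

open MvPolynomial

variable {γ A σ : Type} [CommRing A]

/-- The coefficients of a term whose scalars are constants and variables, as a linear form in the
generators. -/
noncomputable def coeff (t : LinearTerm γ (A ⊕ σ)) : γ → MvPolynomial σ A :=
  open Classical in t.eval (Sum.elim C X) fun g => Pi.single g (1 : MvPolynomial σ A)

theorem coeff_eq_zero {K : Set γ} {t : LinearTerm γ (A ⊕ σ)} (ht : t.UsesOnly K) {g : γ}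
    (hg : g ∉ K) : t.coeff g = 0 := by
  classical
  induction t with
  | gen g' => exact Pi.single_eq_of_ne (ne_of_mem_of_not_mem (s := K) ht hg).symm _
  | zero => rfl
  | smul i t ih => exact mul_eq_zero_of_right _ (ih ht)
  | add s t hs ht' => exact (congrArg₂ (· + ·) (hs ht.1) (ht' ht.2)).trans (add_zero 0)

theorem eval_eq_sum_coeff [Fintype γ] {R X : Type*} [CommRing R] [AddCommGroup X] [Module R X]
    (θ : MvPolynomial σ A →+* R) (x : γ → X) (t : LinearTerm γ (A ⊕ σ)) :
    t.eval (θ ∘ Sum.elim C MvPolynomial.X) x = ∑ g, θ (t.coeff g) • x g := by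
  classical
  induction t with
  | gen g =>
    rw [Finset.sum_eq_single g (fun g' _ hg' => by simp [coeff, eval, hg']) (by simp)]
    simp [coeff, eval]
  | zero => simp [coeff, eval]
  | smul i t ih =>
    simp only [eval, ih, Finset.smul_sum, smul_smul, coeff, Pi.smul_apply, smul_eq_mul, map_mul,
      Function.comp_apply]
  | add s t hs ht =>
    simp only [eval, hs, ht, coeff, Pi.add_apply, map_add, add_smul, Finset.sum_add_distrib]

theorem exists_coeff_eq_smul {K : Set γ} (p : MvPolynomial σ A) {t : LinearTerm γ (A ⊕ σ)}
    (ht : t.UsesOnly K) : ∃ t' : LinearTerm γ (A ⊕ σ), t'.UsesOnly K ∧ t'.coeff = p • t.coeff := by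
  induction p using MvPolynomial.induction_on with
  | C a => exact ⟨smul (.inl a) t, ht, rfl⟩
  | add p q hp hq =>
    obtain ⟨r, hr, hrp⟩ := hp
    obtain ⟨s, hs, hsq⟩ := hq
    exact ⟨add r s, ⟨hr, hs⟩, (congrArg₂ (· + ·) hrp hsq).trans (add_smul p q _).symm⟩
  | mul_X p i hp =>
    obtain ⟨r, hr, hrp⟩ := hp
    refine ⟨smul (.inr i) r, hr, (congrArg (MvPolynomial.X i • ·) hrp).trans ?_⟩
    rw [mul_comm p, mul_smul]

theorem exists_coeff_eq [Finite γ] (v : γ → MvPolynomial σ A) :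
    ∃ t : LinearTerm γ (A ⊕ σ), t.UsesOnly (Function.support v) ∧ t.coeff = v := by
  classical
  have := Fintype.ofFinite γ
  suffices h : ∃ t : LinearTerm γ (A ⊕ σ),
      t.UsesOnly (Function.support v) ∧ t.coeff = ∑ g, Pi.single g (v g) by
    rwa [Finset.univ_sum_single] at h
  refine Finset.sum_induction _ (fun v' => ∃ t : LinearTerm γ (A ⊕ σ),
    t.UsesOnly (Function.support v) ∧ t.coeff = v') ?_ ⟨zero, trivial, rfl⟩ fun g _ => ?_
  · rintro _ _ ⟨s, hs, rfl⟩ ⟨t, ht, rfl⟩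
    exact ⟨add s t, ⟨hs, ht⟩, rfl⟩
  · obtain hg | hg := eq_or_ne (v g) 0
    · exact ⟨zero, trivial, by rw [hg, Pi.single_zero]; rfl⟩
    · obtain ⟨t, ht, h⟩ := exists_coeff_eq_smul (K := Function.support v) (v g)
        (t := (gen g : LinearTerm γ (A ⊕ σ))) hg
      refine ⟨t, ht, h.trans ?_⟩
      simp only [coeff, eval, ← Pi.single_smul, smul_eq_mul, mul_one]

end Coeff

section System

variable {γ κ : Type} {R : Type w}

/-- The element `smul i t` of `s`. -/
def smulIn (s : Set (LinearTerm γ κ)) (p : {p : κ × s // smul p.1 p.2 ∈ s}) : s := ⟨_, p.2⟩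

/-- The element `add a b` of `s`. -/
def addIn (s : Set (LinearTerm γ κ)) (p : {p : s × s // add p.1.1 p.2 ∈ s}) : s := ⟨_, p.2⟩

theorem smulIn_injective (s : Set (LinearTerm γ κ)) : Function.Injective (smulIn s) := by
  rintro ⟨⟨i, t⟩, h⟩ ⟨⟨i', t'⟩, h'⟩ hh
  simpa [smulIn, Subtype.ext_iff] using hh

theorem addIn_injective (s : Set (LinearTerm γ κ)) : Function.Injective (addIn s) := by
  rintro ⟨⟨a, b⟩, h⟩ ⟨⟨a', b'⟩, h'⟩ hh
  simpa [addIn, Subtype.ext_iff] using hh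

variable [CommRing R] (s Z : Set (LinearTerm γ κ)) [Finite s] (ρ : κ → R)

/-- The system of gates, with one unknown for each term in `s`, that evaluates the terms in `s` and
imposes the vanishing of the terms in `Z`. The gates with coefficient `1` impose nothing: they only
ensure that every unknown is the source of a gate. -/
def system : GateSystem R where
  U := s
  E := {p : κ × s // smul p.1 p.2 ∈ s} ⊕ {z : s // z.1 ∈ Z ∨ z.1 = zero} ⊕ s
  G := {p : s × s // add p.1.1 p.2 ∈ s}
  finite_E :=
    have := Finite.of_injective _ (smulIn_injective s)
    inferInstance
  src := Sum.elim (smulIn s) (Sum.elim Subtype.val id)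
  tgt := Sum.elim (fun p => p.1.2) (Sum.elim Subtype.val id)
  coef := Sum.elim (fun p => ρ p.1.1) (Sum.elim 0 1)
  sum := addIn s
  left p := p.1.1
  right p := p.1.2
  exists_src u := ⟨.inr (.inr u), rfl⟩

theorem card_system_E_le : Nat.card (system s Z ρ).E ≤ 3 * s.ncard := by
  have := Finite.of_injective _ (smulIn_injective s)
  have hsmul := Nat.card_le_card_of_injective _ (smulIn_injective s)
  have hZ := Finite.card_subtype_le fun z : s => z.1 ∈ Z ∨ z.1 = zero
  change Nat.card (_ ⊕ _ ⊕ s) ≤ _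
  rw [Nat.card_sum, Nat.card_sum, ← Nat.card_coe_set_eq]
  lia

theorem card_system_G_le : Nat.card (system s Z ρ).G ≤ s.ncard :=
  Nat.card_le_card_of_injective _ (addIn_injective s)

variable {s Z ρ} {X : Type*} [AddCommGroup X] [Module R X] {K : Set γ}

theorem isSolution_eval {x : γ → X} (hx : ∀ z ∈ Z, z.UsesOnly K → z.eval ρ x = 0) :
    (system s Z ρ).IsSolution {u : s | u.1.UsesOnly K} (fun u : s => u.1.eval ρ x) := by
  refine ⟨?_, fun _ _ _ _ => rfl⟩
  rintro (p | ⟨z, hz⟩ | u) h -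
  · rfl
  · refine Eq.trans ?_ (zero_smul R _).symm
    exact hz.elim (fun hz => hx _ hz h) fun hz => congrArg (eval ρ x) hz
  · exact (one_smul R _).symm

theorem eval_eq_of_isSolution (hs : IsSubtermClosed s) (hgen : ∀ g, gen g ∈ s) {y : s → X}
    (hy : (system s Z ρ).IsSolution {u : s | u.1.UsesOnly K} y) {t : LinearTerm γ κ} (ht : t ∈ s)
    (hK : t.UsesOnly K) : t.eval ρ (fun g => y ⟨gen g, hgen g⟩) = y ⟨t, ht⟩ := by
  induction t with
  | gen g => rfl
  | zero => exact ((hy.1 (.inr (.inl ⟨⟨zero, ht⟩, .inr rfl⟩)) hK hK).trans (zero_smul R _)).symm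
  | smul i t ih =>
    have hts := hs.1 i t ht
    exact (congrArg (ρ i • ·) (ih hts hK)).trans (hy.1 (.inl ⟨(i, ⟨t, hts⟩), ht⟩) hK hK).symm
  | add a b iha ihb =>
    have hab := hs.2 a b ht
    exact (congrArg₂ (· + ·) (iha hab.1 hK.1) (ihb hab.2 hK.2)).trans
      (hy.2 ⟨(⟨a, hab.1⟩, ⟨b, hab.2⟩), ht⟩ hK hK.1 hK.2).symm

theorem isUniversal_eval (hs : IsSubtermClosed s) (hgen : ∀ g, gen g ∈ s) (hZ : Z ⊆ s)
    {W : Type w} [AddCommGroup W] [Module R W] {x : γ → W}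
    (hx : ∀ z ∈ Z, z.UsesOnly K → z.eval ρ x = 0)
    (huniv : ∀ (X : Type w) [AddCommGroup X] [Module R X] (x' : γ → X),
      (∀ z ∈ Z, z.UsesOnly K → z.eval ρ x' = 0) → ∃! t : W →ₗ[R] X, ∀ g ∈ K, t (x g) = x' g) :
    (system s Z ρ).IsUniversal {u : s | u.1.UsesOnly K} (fun u : s => u.1.eval ρ x) := by
  refine ⟨isSolution_eval hx, fun X _ _ y hy => ?_⟩
  have heval {t} (ht : t ∈ s) (hK : t.UsesOnly K) := eval_eq_of_isSolution hs hgen hy ht hK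
  obtain ⟨t, ht, huniq⟩ := huniv X (fun g => y ⟨gen g, hgen g⟩) fun z hz hK =>
    (heval (hZ hz) hK).trans
      ((hy.1 (.inr (.inl ⟨⟨z, hZ hz⟩, .inl hz⟩)) hK hK).trans (zero_smul R _))
  exact ⟨t, fun u hK => (map_eval ρ t ht hK).trans (heval u.2 hK),
    fun t' ht' => huniq t' fun g hg => ht' ⟨gen g, hgen g⟩ hg⟩

end System

end LinearTerm

section CircuitBound

open MvPolynomial LinearTerm

variable {A σ γ ι κ μ : Type} [CommRing A]

theorem isUniversal_eval_of_isPresentation [Finite γ] [Fintype κ] (e : κ ↪ γ)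
    {τ : (γ → MvPolynomial σ A) → LinearTerm γ (A ⊕ σ)}
    (hτ : ∀ v, (τ v).UsesOnly (Function.support v)) (hτ' : ∀ v, (τ v).coeff = v)
    {R : Type w} [CommRing R] (θ : MvPolynomial σ A →+* R) {s : Set (LinearTerm γ (A ⊕ σ))}
    [Finite s] (hs : IsSubtermClosed s) (hgen : ∀ g, gen g ∈ s)
    {Z : Set (γ → MvPolynomial σ A)} (hZ : τ '' Z ⊆ s) {W : Type w} [AddCommGroup W] [Module R W]
    {x : γ → W} (hx : IsPresentation (x ∘ e)
      (entrywise θ '' ((· ∘ e) '' {v ∈ Z | Function.support v ⊆ Set.range e}))) :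
    (system s (τ '' Z) (θ ∘ Sum.elim C X)).IsUniversal {u : s | u.1.UsesOnly (Set.range e)}
      (fun u : s => u.1.eval (θ ∘ Sum.elim C X) x) := by
  have := Fintype.ofFinite γ
  have hsupp {v : γ → MvPolynomial σ A} :
      (τ v).UsesOnly (Set.range e) ↔ Function.support v ⊆ Set.range e := by
    refine ⟨fun h => Function.support_subset_iff'.2 fun g hg => ?_, fun h => (hτ v).mono h⟩
    rw [← hτ' v, coeff_eq_zero h hg]
  have heval {Y : Type w} [AddCommGroup Y] [Module R Y] (y : γ → Y) {v : γ → MvPolynomial σ A}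
      (hv : Function.support v ⊆ Set.range e) :
      (τ v).eval (θ ∘ Sum.elim C X) y = ∑ j, θ (v (e j)) • y (e j) := by
    rw [eval_eq_sum_coeff, hτ']
    refine (Fintype.sum_of_injective e e.injective _ _ (fun g hg => ?_) fun _ => rfl).symm
    rw [Function.support_subset_iff'.1 hv g hg, map_zero, zero_smul]
  refine isUniversal_eval hs hgen hZ ?_ fun Y _ _ y hy => ?_
  · rintro _ ⟨v, hv, rfl⟩ hK
    rw [heval x (hsupp.1 hK)]
    exact hx.sum_smul_eq_zero ⟨_, ⟨v, ⟨hv, hsupp.1 hK⟩, rfl⟩, rfl⟩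
  · simp only [Set.forall_mem_range]
    refine hx.existsUnique_linearMap (x' := y ∘ e) ?_
    rintro _ ⟨_, ⟨v, ⟨hv, hK⟩, rfl⟩, rfl⟩
    exact (heval y hK).symm.trans (hy _ ⟨v, hv, rfl⟩ (hsupp.2 hK))

theorem exists_forall_computes_of_isPresentation [Fintype γ] [Fintype κ] (e : κ ↪ γ)
    {V : Set (γ → MvPolynomial σ A)} (hV : V.Finite) :
    ∃ b : ℕ, ∀ (R : Type w) [CommRing R] (B : MorphismProperty (ModuleCat.{w} R))
      (θ : MvPolynomial σ A →+* R),
      (∀ a, B (ModuleCat.ofHom (LinearMap.lsmul R R (θ (C a))))) →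
      (∀ i, B (ModuleCat.ofHom (LinearMap.lsmul R R (θ (X i))))) →
      B (ModuleCat.ofHom (LinearMap.inl R R R)) → B (ModuleCat.ofHom (LinearMap.inr R R R)) →
      B (ModuleCat.ofHom (LinearMap.prod (LinearMap.id : R →ₗ[R] R) LinearMap.id)) →
      ∀ Z ⊆ V, ∀ (W W' : ModuleCat.{w} R) (x : κ → W) (x' : γ → W'),
      IsPresentation x
        (entrywise θ '' ((· ∘ e) '' {v ∈ Z | Function.support v ⊆ Set.range e})) →
      IsPresentation x' (entrywise θ '' Z) →
      ∀ f : W ⟶ W', (∀ j, f (x j) = x' (e j)) →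
      ∃ Q : ColimitComputation B, Q.Computes (morphismDiagram f) ∧ Q.size ≤ b := by
  choose τ hτ hτ' using exists_coeff_eq (γ := γ) (A := A) (σ := σ)
  obtain ⟨s, hs, hfin, hclosed⟩ :=
    exists_finite_isSubtermClosed ((hV.image τ).union (Set.finite_range gen))
  rw [Set.union_subset_iff, Set.range_subset_iff] at hs
  have : Finite s := hfin
  refine ⟨2 + (3 * s.ncard + 3 * s.ncard), ?_⟩
  intro R _ B θ hC hX hinl hinr hdiag Z hZV W W' x x' hx hx' f hf
  have hZ : τ '' Z ⊆ s := (Set.image_mono hZV).trans hs.1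
  have hext : Function.extend e x 0 ∘ e = x := Function.extend_comp e.injective _ _
  have hinner := isUniversal_eval_of_isPresentation e hτ hτ' θ hclosed hs.2 hZ
    (x := Function.extend e x 0) (by rwa [hext])
  have htotal := isUniversal_eval_of_isPresentation (.refl γ) hτ hτ' θ hclosed hs.2 hZ (x := x')
    (by simpa [Function.comp_def] using hx')
  have huniv : {u : s | u.1.UsesOnly (Set.range (Function.Embedding.refl γ))} = Set.univ := by
    refine Set.eq_univ_of_forall fun u => (usesOnly_univ u.1).mono (K := Set.univ) ?_
    exact fun g _ => Set.mem_range_self (f := Function.Embedding.refl γ) g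
  have hmul (c : (system s (τ '' Z) (θ ∘ Sum.elim C X)).E) :
      B (ModuleCat.ofHom (LinearMap.lsmul R R ((system s (τ '' Z) _).coef c))) := by
    rcases c with ⟨⟨a | i, t⟩, _⟩ | z | u
    · exact hC a
    · exact hX i
    · simpa [system] using hC 0
    · simpa [system] using hC 1
  have hf' : ∀ g ∈ Set.range e, f.hom (Function.extend e x 0 g) = x' g :=
    Set.forall_mem_range.2 fun j => (congrArg f (congrFun hext j)).trans (hf j)
  obtain ⟨Q, hQ, hsize⟩ := GateSystem.exists_computes (A := B) (f := f) hmul hinl hinr hdiag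
    hinner (huniv ▸ htotal) fun u hu => LinearTerm.map_eval _ f.hom hf' hu
  exact ⟨Q, hQ, hsize.trans (by grw [card_system_E_le, card_system_G_le])⟩

theorem IsPresentation.entrywise_image [Fintype γ] {R N : Type*} [CommRing R] [AddCommGroup N]
    [Module R N] {θ : MvPolynomial σ A →+* R} {x : γ → N} {Z : Set (γ → R)}
    (h : IsPresentation x Z) {V : Set (γ → MvPolynomial σ A)} (hV : Z ⊆ entrywise θ '' V) :
    IsPresentation x (entrywise θ '' {v ∈ V | ∑ g, θ (v g) • x g = 0}) := by
  refine h.of_superset (fun z hz => ?_) ?_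
  · obtain ⟨v, hv, rfl⟩ := hV hz
    exact ⟨v, ⟨hv, h.sum_smul_eq_zero hz⟩, rfl⟩
  · rintro _ ⟨v, hv, rfl⟩
    exact hv.2

theorem exists_finite_isPresentation_sumElim [Fintype ι] [Fintype κ] [Fintype μ]
    (M : Matrix ι (κ ⊕ μ) (MvPolynomial σ A)) {T : Set (κ ⊕ μ → MvPolynomial σ A)}
    (hTfin : T.Finite) :
    ∃ V : Set (κ ⊕ ι → MvPolynomial σ A), V.Finite ∧
      ∀ (R N : Type w) [CommRing R] [AddCommGroup N] [Module R N] (θ : MvPolynomial σ A →+* R)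
        (x : ι → N) (L : Submodule R N) (y : κ → L), GeneratesSyzygies θ M T →
        IsPresentation x (Set.range fun r i => θ (M i (Sum.inr r))) →
        (∀ j, (y j : N) = ∑ i, θ (M i (Sum.inl j)) • x i) →
        Submodule.span R (Set.range fun j => (y j : N)) = L →
        ∃ Z ⊆ V, IsPresentation y (entrywise θ '' ((· ∘ Sum.inl) ''
            {v ∈ Z | Function.support v ⊆ Set.range Sum.inl})) ∧
          IsPresentation (Sum.elim (fun j => (y j : N)) x) (entrywise θ '' Z) := by
  classical
  let V : Set (κ ⊕ ι → MvPolynomial σ A) :=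
    (fun t => Sum.elim (t ∘ Sum.inl) 0) '' T ∪
      Set.range (fun j => Sum.elim (Pi.single j 1) fun i => -M i (Sum.inl j)) ∪
      Set.range (fun r => Sum.elim 0 fun i => M i (Sum.inr r))
  refine ⟨V, ((hTfin.image _).union (Set.finite_range _)).union (Set.finite_range _), ?_⟩
  intro R N _ _ _ θ x L y hT hx hy hL
  refine ⟨{v ∈ V | ∑ g, θ (v g) • Sum.elim (fun j => (y j : N)) x g = 0}, Set.sep_subset _ _,
    ?_, (hx.sumElim (B := fun j i => θ (M i (Sum.inl j))) hy).entrywise_image ?_⟩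
  · have hker : LinearMap.ker (M.map θ).mulVecLin =
        Submodule.span R (entrywise θ '' T ∩ syzygies θ M) :=
      le_antisymm hT (Submodule.span_le.2 Set.inter_subset_right)
    have hpres : IsPresentation y _ := IsPresentation.restrict (M := M.map θ) hx hy hL hker
    refine hpres.of_superset ?_ ?_
    · rintro _ ⟨_, ⟨⟨t, ht, rfl⟩, htsyz⟩, rfl⟩
      have h0 := congrArg L.subtype
        (hpres.sum_smul_eq_zero ⟨entrywise θ t, ⟨⟨t, ht, rfl⟩, htsyz⟩, rfl⟩)
      refine ⟨_, ⟨Sum.elim (t ∘ Sum.inl) 0, ⟨⟨.inl (.inl ⟨t, ht, rfl⟩), ?_⟩, ?_⟩, rfl⟩, rfl⟩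
      · simpa [entrywise] using h0
      · rintro (j | i) hg
        · exact ⟨j, rfl⟩
        · exact absurd rfl hg
    · rintro _ ⟨_, ⟨v, ⟨⟨-, hv⟩, hsupp⟩, rfl⟩, rfl⟩
      have hinr (i : ι) : v (Sum.inr i) = 0 :=
        Function.support_subset_iff'.1 hsupp _ (by simp)
      refine Subtype.ext ?_
      simpa [entrywise, hinr] using hv
  · rintro _ (⟨j, rfl⟩ | ⟨_, ⟨r, rfl⟩, rfl⟩)
    · refine ⟨_, .inl (.inr ⟨j, rfl⟩), ?_⟩
      ext (j' | i) <;> simp [entrywise, Pi.single_apply, apply_ite θ]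
    · refine ⟨_, .inr ⟨r, rfl⟩, ?_⟩
      ext (j | i) <;> simp [entrywise]

theorem exists_forall_computes_subtype [IsNoetherianRing A] [Finite σ] [Fintype ι] [Finite κ]
    [Finite μ] (M : Matrix ι (κ ⊕ μ) (MvPolynomial σ A)) :
    ∃ b : ℕ, ∀ (k : Type w) [Field k] (φ : A →+* k) (n : ℕ) (g : σ → Fin n),
      Function.Injective g → ∀ (N : ModuleCat.{w} (MvPolynomial (Fin n) k)) (x : ι → N),
      IsPresentation x (Set.range fun r i => specialize φ g (M i (Sum.inr r))) →
      ∀ L : Submodule (MvPolynomial (Fin n) k) N,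
      Submodule.span _ (Set.range fun j => ∑ i, specialize φ g (M i (Sum.inl j)) • x i) = L →
      ∃ Q : ColimitComputation (PolyModBasic k n),
        Q.Computes (morphismDiagram (ModuleCat.ofHom L.subtype)) ∧ Q.size ≤ b := by
  have := Fintype.ofFinite κ
  have := Fintype.ofFinite μ
  obtain ⟨T, hTfin, hT⟩ := exists_finite_generatesSyzygies_specialize.{w} M
  obtain ⟨V, hVfin, hV⟩ := exists_finite_isPresentation_sumElim.{w} M hTfin
  obtain ⟨b, hb⟩ := exists_forall_computes_of_isPresentation.{w} (A := A) (σ := σ)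
    (.inl : κ ↪ κ ⊕ ι) hVfin
  refine ⟨b, fun k _ φ n g hg N x hx L hL => ?_⟩
  have hmem (j : κ) : ∑ i, specialize φ g (M i (Sum.inl j)) • x i ∈ L :=
    hL.le (Submodule.subset_span ⟨j, rfl⟩)
  obtain ⟨Z, hZV, hZ, hZ'⟩ := hV _ N (specialize φ g) x L (fun j => ⟨_, hmem j⟩) (hT k φ n g hg)
    hx (fun _ => rfl) hL
  exact hb _ (PolyModBasic k n) (specialize φ g) (fun a => specialize_C φ g a ▸ .const _)
    (fun i => specialize_X φ g i ▸ .var _) .inl .inr .diag Z hZV (.of _ L) N _ _ hZ hZ'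
    (ModuleCat.ofHom L.subtype) fun _ => rfl

end CircuitBound

section Restriction

variable {C : Type u} [Category.{v} C]

theorem IsColimitOn.hom_ext {V : Type} [Quiver.{0} V] {D : V ⥤q C} {J : DiSubgraph V} {W : C}
    {φ : ∀ a : J.verts, D.obj a.1 ⟶ W} (h : IsColimitOn D J W φ) {X : C} {t t' : W ⟶ X}
    (ht : ∀ a, φ a ≫ t = φ a ≫ t') : t = t' :=
  (h.2 X (fun a => φ a ≫ t') fun e he => by rw [← Category.assoc, h.1 e he]).unique ht fun _ => rfl

namespace ColimitComputation

variable {A : MorphismProperty C} (P : ColimitComputation A)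

theorem monotone_verts : Monotone fun i => (P.shape i).verts :=
  Fin.monotone_iff_le_succ.2 fun i => (Set.subset_insert _ _).trans (P.verts_succ i).ge

theorem monotone_edges : Monotone fun i => (P.shape i).edges :=
  Fin.monotone_iff_le_succ.2 fun i => Set.subset_union_left.trans (P.edges_succ i).ge

theorem mem_shape_verts {i : Fin (P.steps + 1)} {a : P.V} (ha : a ∈ (P.shape i).verts) :
    a ∈ (P.shape 0).verts ∨ ∃ l : Fin P.steps, a = P.apex l := by
  induction i using Fin.induction with
  | zero => exact .inl ha
  | succ i ih =>
    rw [P.verts_succ] at ha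
    exact ha.elim (fun h => .inr ⟨i, h⟩) ih

theorem mem_shape_edges {i : Fin (P.steps + 1)} {e : Quiver.Total P.V}
    (he : e ∈ (P.shape i).edges) :
    e ∈ (P.shape 0).edges ∨ ∃ (l : Fin P.steps) (a : (P.sub l).verts),
      e = Quiver.Total.mk a.1 (P.apex l) (P.leg l a) := by
  induction i using Fin.induction with
  | zero => exact .inl he
  | succ i ih =>
    rw [P.edges_succ] at he
    exact he.elim ih fun ⟨a, h⟩ => .inr ⟨i, a, h.symm⟩

theorem apex_mem_shape {l : Fin P.steps} {i : Fin (P.steps + 1)} :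
    P.apex l ∈ (P.shape i).verts ↔ l.castSucc < i := by
  refine ⟨fun h => lt_of_not_ge fun hle => P.apex_new l (P.monotone_verts hle h), fun h => ?_⟩
  exact P.monotone_verts (Fin.castSucc_lt_iff_succ_le.1 h)
    ((P.verts_succ l).ge (Set.mem_insert _ _))

theorem apex_notMem_shape_zero (l : Fin P.steps) : P.apex l ∉ (P.shape 0).verts := fun h =>
  absurd (P.apex_mem_shape.1 h) (Fin.not_lt_zero _)

theorem apex_injective : Function.Injective P.apex := by
  have hne : ∀ i j, i < j → P.apex i ≠ P.apex j := fun i j hij h =>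
    P.apex_new j (h ▸ P.apex_mem_shape.2 hij)
  intro i j h
  by_contra! hij
  exact hij.lt_or_gt.elim (fun hlt => hne i j hlt h) fun hlt => hne j i hlt h.symm

theorem lt_of_apex_mem_sub {l i : Fin P.steps} (h : P.apex l ∈ (P.sub i).verts) : l < i :=
  Fin.castSucc_lt_castSucc_iff.1 (P.apex_mem_shape.1 ((P.sub_full i).1.1 h))

theorem sub_le_sub {l i : Fin P.steps} (h : P.apex l ∈ (P.sub i).verts) : P.sub l ≤ P.sub i :=
  P.constructive l i (P.lt_of_apex_mem_sub h) h

theorem leg_mem_sub_edges {l i : Fin P.steps} (h : P.apex l ∈ (P.sub i).verts)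
    (a : (P.sub l).verts) :
    Quiver.Total.mk a.1 (P.apex l) (P.leg l a) ∈ (P.sub i).edges := by
  refine (P.sub_full i).2 _ ?_ ((P.sub_le_sub h).1 a.2) h
  have hle : l.succ ≤ i.castSucc :=
    Fin.castSucc_lt_iff_succ_le.1 (Fin.castSucc_lt_castSucc_iff.2 (P.lt_of_apex_mem_sub h))
  exact P.monotone_edges hle ((P.edges_succ l).ge (.inr ⟨a, rfl⟩))

theorem map_leg_comp_map_leg {l i : Fin P.steps} (h : P.apex l ∈ (P.sub i).verts)
    (a : (P.sub l).verts) :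
    P.diagram.map (P.leg l a) ≫ P.diagram.map (P.leg i ⟨P.apex l, h⟩) =
      P.diagram.map (P.leg i ⟨a.1, (P.sub_le_sub h).1 a.2⟩) :=
  (P.isColimit i).1 _ (P.leg_mem_sub_edges h a)

theorem exists_eq_leg {l : Fin P.steps} {i : Fin (P.steps + 1)} {a : P.V} {e : a ⟶ P.apex l}
    (he : Quiver.Total.mk a (P.apex l) e ∈ (P.shape i).edges) :
    ∃ ha : a ∈ (P.sub l).verts, e = P.leg l ⟨a, ha⟩ := by
  rcases P.mem_shape_edges he with h0 | ⟨l', ⟨b, hb⟩, h⟩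
  · exact absurd ((P.shape 0).right_mem _ h0) (P.apex_notMem_shape_zero l)
  · obtain rfl : l = l' := P.apex_injective (congrArg Quiver.Total.right h)
    cases h
    exact ⟨hb, rfl⟩

/-- The part of the subdiagram chosen in a step that belongs to the initial diagram. -/
def basicSub (i : Fin P.steps) : DiSubgraph P.V where
  verts := (P.sub i).verts ∩ (P.shape 0).verts
  edges := (P.sub i).edges ∩ (P.shape 0).edges
  left_mem e he := ⟨(P.sub i).left_mem e he.1, (P.shape 0).left_mem e he.2⟩
  right_mem e he := ⟨(P.sub i).right_mem e he.1, (P.shape 0).right_mem e he.2⟩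

theorem basicSub_le (i : Fin P.steps) : P.basicSub i ≤ P.shape 0 :=
  ⟨Set.inter_subset_right, Set.inter_subset_right⟩

/-- The legs at the vertices of the initial diagram. -/
def basicLeg (i : Fin P.steps) (a : (P.basicSub i).verts) :
    P.diagram.obj a.1 ⟶ P.diagram.obj (P.apex i) :=
  P.diagram.map (P.leg i ⟨a.1, a.2.1⟩)

theorem mem_basicSub_of_apex_mem_sub {l i : Fin P.steps} (h : P.apex l ∈ (P.sub i).verts)
    {a : P.V} (ha : a ∈ (P.basicSub l).verts) : a ∈ (P.basicSub i).verts :=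
  ⟨(P.sub_le_sub h).1 ha.1, ha.2⟩

/-- The morphism `f` can serve as the component at `a` of a cocone on `P.sub i` that extends the
cocone `ψ` on `P.basicSub i`. -/
structure IsExtensionAt {i : Fin P.steps} {X : C}
    (ψ : ∀ a : (P.basicSub i).verts, P.diagram.obj a.1 ⟶ X) (a : P.V) (f : P.diagram.obj a ⟶ X) :
    Prop where
  eq_of_mem : ∀ h : a ∈ (P.basicSub i).verts, f = ψ ⟨a, h⟩
  map_comp : ∀ (b : (P.basicSub i).verts) (e : b.1 ⟶ a),
    Quiver.Total.mk b.1 a e ∈ (P.sub i).edges → P.diagram.map e ≫ f = ψ b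

variable {P} {i : Fin P.steps} {X : C} {ψ : ∀ a : (P.basicSub i).verts, P.diagram.obj a.1 ⟶ X}

theorem IsExtensionAt.basicLeg_comp {l : Fin P.steps} {f : P.diagram.obj (P.apex l) ⟶ X}
    (hf : P.IsExtensionAt ψ (P.apex l) f) (h : P.apex l ∈ (P.sub i).verts)
    (b : (P.basicSub l).verts) :
    P.basicLeg l b ≫ f = ψ ⟨b.1, P.mem_basicSub_of_apex_mem_sub h b.2⟩ :=
  hf.map_comp ⟨b.1, P.mem_basicSub_of_apex_mem_sub h b.2⟩ _ (P.leg_mem_sub_edges h ⟨b.1, b.2.1⟩)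

theorem existsUnique_isExtensionAt
    (ih : ∀ l < i, IsColimitOn P.diagram (P.basicSub l) (P.diagram.obj (P.apex l)) (P.basicLeg l))
    (hψ : IsCoconeOn P.diagram (P.basicSub i) X ψ) {a : P.V} (ha : a ∈ (P.sub i).verts) :
    ∃! f, P.IsExtensionAt ψ a f := by
  rcases P.mem_shape_verts ((P.sub_full i).1.1 ha) with h0 | ⟨l, rfl⟩
  · refine ⟨ψ ⟨a, ha, h0⟩, ⟨fun _ => rfl, fun b e he => hψ _ ⟨he, ?_⟩⟩,
      fun f hf => hf.eq_of_mem ⟨ha, h0⟩⟩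
    rcases P.mem_shape_edges ((P.sub_full i).1.2 he) with h | ⟨l, _, h⟩
    · exact h
    · obtain rfl : a = P.apex l := congrArg Quiver.Total.right h
      exact absurd h0 (P.apex_notMem_shape_zero l)
  · have hle := P.sub_le_sub ha
    have hcolim := ih l (P.lt_of_apex_mem_sub ha)
    obtain ⟨t, ht, -⟩ := hcolim.2 X (fun b => ψ ⟨b.1, P.mem_basicSub_of_apex_mem_sub ha b.2⟩)
      fun e he => hψ e ⟨hle.2 he.1, he.2⟩
    refine ⟨t, ⟨fun h => absurd h.2 (P.apex_notMem_shape_zero l), fun b e he => ?_⟩,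
      fun f hf => hcolim.hom_ext fun b => (hf.basicLeg_comp ha b).trans (ht b).symm⟩
    obtain ⟨hb, rfl⟩ := P.exists_eq_leg ((P.sub_full i).1.2 he)
    exact ht ⟨b.1, hb, b.2.2⟩

theorem isCoconeOn_of_isExtensionAt
    (ih : ∀ l < i, IsColimitOn P.diagram (P.basicSub l) (P.diagram.obj (P.apex l)) (P.basicLeg l))
    {χ : ∀ a : (P.sub i).verts, P.diagram.obj a.1 ⟶ X} (hχ : ∀ a, P.IsExtensionAt ψ a.1 (χ a)) :
    IsCoconeOn P.diagram (P.sub i) X χ := by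
  rintro ⟨a, b, e⟩ he
  have ha : a ∈ (P.sub i).verts := (P.sub i).left_mem _ he
  have hb : b ∈ (P.sub i).verts := (P.sub i).right_mem _ he
  change P.diagram.map e ≫ χ ⟨b, hb⟩ = χ ⟨a, ha⟩
  rcases P.mem_shape_verts ((P.sub_full i).1.1 ha) with h0 | ⟨j, rfl⟩
  · exact ((hχ ⟨b, hb⟩).map_comp ⟨a, ha, h0⟩ e he).trans ((hχ ⟨a, ha⟩).eq_of_mem ⟨ha, h0⟩).symm
  · rcases P.mem_shape_verts ((P.sub_full i).1.1 hb) with h0 | ⟨l, rfl⟩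
    · rcases P.mem_shape_edges ((P.sub_full i).1.2 he) with h | ⟨l, _, h⟩
      · exact absurd ((P.shape 0).left_mem _ h) (P.apex_notMem_shape_zero j)
      · obtain rfl : b = P.apex l := congrArg Quiver.Total.right h
        exact absurd h0 (P.apex_notMem_shape_zero l)
    · obtain ⟨hj, rfl⟩ := P.exists_eq_leg ((P.sub_full i).1.2 he)
      refine (ih j (P.lt_of_apex_mem_sub ha)).hom_ext fun c => ?_
      have hcomp : P.basicLeg j c ≫ P.diagram.map (P.leg l ⟨P.apex j, hj⟩) =
          P.basicLeg l ⟨c.1, P.mem_basicSub_of_apex_mem_sub hj c.2⟩ :=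
        P.map_leg_comp_map_leg hj ⟨c.1, c.2.1⟩
      rw [← Category.assoc, hcomp, (hχ ⟨_, hb⟩).basicLeg_comp hb, (hχ ⟨_, ha⟩).basicLeg_comp ha]

variable (P)

theorem isColimitOn_basicSub (i : Fin P.steps) :
    IsColimitOn P.diagram (P.basicSub i) (P.diagram.obj (P.apex i)) (P.basicLeg i) := by
  induction i using WellFoundedLT.induction with
  | ind i ih =>
  refine ⟨fun e he => (P.isColimit i).1 e he.1, fun X ψ hψ => ?_⟩
  choose χ hχ hunique using fun a : (P.sub i).verts => existsUnique_isExtensionAt ih hψ a.2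
  obtain ⟨t, ht, htunique⟩ := (P.isColimit i).2 X χ (isCoconeOn_of_isExtensionAt ih hχ)
  refine ⟨t, fun a => (ht ⟨a.1, a.2.1⟩).trans ((hχ ⟨a.1, a.2.1⟩).eq_of_mem a.2), fun t' ht' =>
    htunique t' fun a => hunique a _ ⟨fun h => ht' ⟨a.1, h⟩, fun b e he => ?_⟩⟩
  rw [← Category.assoc]
  exact (congrArg (· ≫ t') ((P.isColimit i).1 _ he)).trans (ht' b)

end ColimitComputation

end Restriction

section Gluing

variable {R : Type*} [CommRing R] {V : Type} [Quiver.{0} V] {γ ρ : Type}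

open Classical in
/-- The relations of a colimit over `J` of modules with presentations of the same shape, where the
module at `a` has the relations `Z a` and the edge `e` acts on the generators by the matrix `B e`:
those of the modules, and those identifying the generators along the edges. -/
noncomputable def gluingRelation (J : DiSubgraph V) (Z : V → Matrix ρ γ R)
    (B : Quiver.Total V → Matrix γ γ R) :
    (J.verts × ρ) ⊕ (J.edges × γ) → J.verts × γ → R
  | .inl (a, r) => Function.uncurry (Pi.single a (Z a r))
  | .inr (e, i) => Function.uncurry (Pi.single ⟨e.1.left, J.left_mem e.1 e.2⟩ (Pi.single i 1) -
      Pi.single ⟨e.1.right, J.right_mem e.1 e.2⟩ (B e.1 i))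

variable {J : DiSubgraph V} {Z : V → Matrix ρ γ R} {B : Quiver.Total V → Matrix γ γ R}

theorem gluingRelation_mem {S : AddSubgroup R} (h1 : 1 ∈ S) (hZ : ∀ a r i, Z a r i ∈ S)
    (hB : ∀ e i j, B e i j ∈ S) (s : (J.verts × ρ) ⊕ (J.edges × γ)) (p : J.verts × γ) :
    gluingRelation J Z B s p ∈ S := by
  classical
  have hsingle {a b : J.verts} {f : γ → R} (hf : ∀ i, f i ∈ S) (i : γ) :
      (Pi.single a f : J.verts → γ → R) b i ∈ S := by
    rcases eq_or_ne b a with rfl | hb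
    · simpa using hf i
    · simp [hb]
  rcases s with ⟨a, r⟩ | ⟨e, i⟩
  · exact hsingle (hZ a r) p.2
  · refine S.sub_mem (hsingle (fun j => ?_) p.2) (hsingle (hB e.1 i) p.2)
    rcases eq_or_ne j i with rfl | hj
    · simpa using h1
    · simp [hj]

variable [Fintype J.verts] [Fintype γ] {N : Type*} [AddCommGroup N] [Module R N]

theorem sum_gluingRelation_inl_smul (a : J.verts) (r : ρ) (y : J.verts × γ → N) :
    ∑ p, gluingRelation J Z B (.inl (a, r)) p • y p = ∑ i, Z a r i • y (a, i) := by
  rw [Fintype.sum_prod_type, Fintype.sum_eq_single a fun b hb => by simp [gluingRelation, hb]]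
  simp [gluingRelation]

theorem sum_gluingRelation_inr_smul (e : J.edges) (i : γ) (y : J.verts × γ → N) :
    ∑ p, gluingRelation J Z B (.inr (e, i)) p • y p =
      y (⟨e.1.left, J.left_mem e.1 e.2⟩, i) -
        ∑ j, B e.1 i j • y (⟨e.1.right, J.right_mem e.1 e.2⟩, j) := by
  simp only [gluingRelation, Function.uncurry_def, Pi.sub_apply, sub_smul, Finset.sum_sub_distrib,
    Fintype.sum_prod_type]
  congr 1
  · rw [Fintype.sum_eq_single (⟨e.1.left, J.left_mem e.1 e.2⟩ : J.verts) fun b hb => by simp [hb],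
      Fintype.sum_eq_single i fun j hj => by simp [hj]]
    simp
  · rw [Fintype.sum_eq_single (⟨e.1.right, J.right_mem e.1 e.2⟩ : J.verts)
      fun b hb => by simp [hb]]
    simp

end Gluing

theorem IsColimitOn.isPresentation {R : Type w} [CommRing R] {V : Type} [Quiver.{0} V]
    {γ ρ : Type} [Fintype γ] {D : V ⥤q ModuleCat.{w} R} {J : DiSubgraph V} [Fintype J.verts]
    {W : ModuleCat.{w} R} {leg : ∀ a : J.verts, D.obj a.1 ⟶ W} (h : IsColimitOn D J W leg)
    {x : ∀ a, γ → D.obj a} {Z : V → Matrix ρ γ R} {B : Quiver.Total V → Matrix γ γ R}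
    (hx : ∀ a ∈ J.verts, IsPresentation (x a) (Set.range (Z a)))
    (hB : ∀ e ∈ J.edges, ∀ i, (D.map e.hom).hom (x e.left i) = ∑ j, B e i j • x e.right j) :
    IsPresentation (fun p : J.verts × γ => (leg p.1).hom (x p.1 p.2))
      (Set.range (gluingRelation J Z B)) := by
  have hsum (a : J.verts) (c : γ → R) :
      ∑ i, c i • (leg a).hom (x a.1 i) = (leg a).hom (∑ i, c i • x a.1 i) := by simp
  refine isPresentation_of_existsUnique ?_ fun X _ _ y hy => ?_
  · rintro _ ⟨⟨a, r⟩ | ⟨e, i⟩, rfl⟩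
    · rw [sum_gluingRelation_inl_smul]
      exact (hsum a _).trans ((congrArg (leg a).hom
        ((hx a a.2).sum_smul_eq_zero ⟨r, rfl⟩)).trans (map_zero (leg a).hom))
    · rw [sum_gluingRelation_inr_smul, sub_eq_zero]
      exact ((congrArg (·.hom (x e.1.left i)) (h.1 e.1 e.2).symm).trans
        (congrArg (leg _).hom (hB e.1 e.2 i))).trans (hsum ⟨e.1.right, _⟩ _).symm
  · have hlift (a : J.verts) : ∃! t : D.obj a.1 →ₗ[R] X, ∀ i, t (x a.1 i) = y (a, i) :=
      (hx a a.2).existsUnique_linearMap (by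
        rintro _ ⟨r, rfl⟩
        rw [← sum_gluingRelation_inl_smul (B := B)]
        exact hy _ ⟨.inl (a, r), rfl⟩)
    choose ψ hψ hunique using hlift
    have hcocone : IsCoconeOn D J (ModuleCat.of R X) fun a => ModuleCat.ofHom (ψ a) := by
      intro e he
      refine ModuleCat.hom_ext (hunique ⟨e.left, J.left_mem e he⟩ _ fun i => ?_)
      have hrel := hy _ ⟨.inr (⟨e, he⟩, i), rfl⟩
      rw [sum_gluingRelation_inr_smul, sub_eq_zero] at hrel
      refine (congrArg (ψ _) (hB e he i)).trans (Eq.trans ?_ hrel.symm)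
      rw [map_sum]
      simp only [map_smul, hψ]
    obtain ⟨t, ht, htunique⟩ := h.2 (ModuleCat.of R X) _ hcocone
    refine ⟨t.hom, fun p => (congrArg (·.hom (x p.1.1 p.2)) (ht p.1)).trans (hψ p.1 p.2),
      fun t' ht' => congrArg ModuleCat.Hom.hom (htunique (ModuleCat.ofHom t') fun a => ?_)⟩
    exact ModuleCat.hom_ext (hunique a _ fun i => ht' (a, i))

section StandardGenerators

variable {R : Type w} [CommRing R]

open Classical in
/-- The standard bases of `R` and `R ⊕ R`, padded by zeros to two elements. The basic morphisms
have the modules `R`, `R ⊕ R` and `{0}` themselves as source and target, so that the equality of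
objects tells the cases apart; for all other modules the value is `0`. -/
noncomputable def stdGen (X : ModuleCat.{w} R) : Fin 2 → X :=
  if h : X = ModuleCat.of R R then fun i => (eqToHom h.symm).hom (![(1 : R), 0] i)
  else if h : X = ModuleCat.of R (R × R) then
    fun i => (eqToHom h.symm).hom (![((1 : R), (0 : R)), (0, 1)] i)
  else 0

theorem stdGen_self : stdGen (ModuleCat.of R R) = ![(1 : R), 0] := by
  rw [stdGen, dif_pos rfl]
  rfl

theorem stdGen_prod [Nontrivial R] :
    stdGen (ModuleCat.of R (R × R)) = ![((1 : R), (0 : R)), (0, 1)] := by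
  have h : ModuleCat.of R (R × R) ≠ ModuleCat.of R R := by
    intro h
    have h1 := (eqToIso h).toLinearEquiv.finrank_eq
    change Module.finrank R (R × R) = Module.finrank R R at h1
    rw [Module.finrank_prod, Module.finrank_self] at h1
    omega
  rw [stdGen, dif_neg h, dif_pos rfl]
  rfl

/-- The module `X` is presented on its standard generators, with coefficients `0` and `1` in the
relations. -/
def IsStdPresented (X : ModuleCat.{w} R) : Prop :=
  ∃ Z : Matrix (Fin 2) (Fin 2) R, (∀ i j, Z i j = 0 ∨ Z i j = 1) ∧
    IsPresentation (stdGen X) (Set.range Z)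

theorem isStdPresented_self : IsStdPresented (ModuleCat.of R R) := by
  refine ⟨!![0, 0; 0, 1], fun i j => by fin_cases i <;> fin_cases j <;> simp, ?_⟩
  rw [stdGen_self]
  refine isPresentation_of_existsUnique (N := R) ?_ fun X _ _ y hy => ?_
  · rintro _ ⟨r, rfl⟩
    fin_cases r <;> simp
  · have hy1 : y 1 = 0 := by simpa using hy _ ⟨1, rfl⟩
    refine ⟨LinearMap.toSpanSingleton R X (y 0), fun i => ?_, fun t ht => ?_⟩
    · fin_cases i <;> simp [hy1]
    · refine LinearMap.ext_ring ?_
      simpa using ht 0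

theorem isStdPresented_prod [Nontrivial R] : IsStdPresented (ModuleCat.of R (R × R)) := by
  refine ⟨0, fun _ _ => .inl rfl, ?_⟩
  rw [stdGen_prod]
  refine isPresentation_of_existsUnique (N := R × R) ?_ fun X _ _ y _ => ?_
  · rintro _ ⟨r, rfl⟩
    simp
  · refine ⟨(LinearMap.toSpanSingleton R X (y 0)).coprod (LinearMap.toSpanSingleton R X (y 1)),
      fun i => ?_, fun t ht => ?_⟩
    · fin_cases i <;> simp
    · ext
      · simpa using ht 0
      · simpa using ht 1

theorem isStdPresented_punit : IsStdPresented (ModuleCat.of R PUnit.{w + 1}) := by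
  refine ⟨1, fun i j => by fin_cases i <;> fin_cases j <;> simp, ?_⟩
  refine isPresentation_of_existsUnique (N := PUnit.{w + 1})
    (fun _ _ => Subsingleton.elim (α := PUnit.{w + 1}) _ _) fun X _ _ y hy => ?_
  have hy0 (i : Fin 2) : y i = 0 := by simpa [Matrix.one_apply] using hy _ ⟨i, rfl⟩
  exact ⟨0, fun i => (hy0 i).symm, fun t _ => Subsingleton.elim t 0⟩

end StandardGenerators

section AffineForms

variable {k : Type w} [Field k] {n : ℕ}

/-- The affine linear forms in the variables from `J`. -/
noncomputable def affineForms (k : Type w) [Field k] {n : ℕ} (J : Finset (Fin n)) :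
    Submodule k (MvPolynomial (Fin n) k) :=
  Submodule.span k (insert 1 (MvPolynomial.X '' (J : Set (Fin n))))

theorem one_mem_affineForms (J : Finset (Fin n)) : 1 ∈ affineForms k J :=
  Submodule.subset_span (Set.mem_insert _ _)

theorem C_mem_affineForms (c : k) (J : Finset (Fin n)) : MvPolynomial.C c ∈ affineForms k J := by
  rw [← mul_one (MvPolynomial.C c), ← MvPolynomial.smul_eq_C_mul]
  exact Submodule.smul_mem _ _ (one_mem_affineForms J)

theorem X_mem_affineForms {i : Fin n} {J : Finset (Fin n)} (h : i ∈ J) :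
    MvPolynomial.X i ∈ affineForms k J :=
  Submodule.subset_span (Or.inr ⟨i, h, rfl⟩)

theorem affineForms_mono {J J' : Finset (Fin n)} (h : J ⊆ J') :
    affineForms k J ≤ affineForms k J' :=
  Submodule.span_mono (Set.insert_subset_insert (Set.image_mono (Finset.coe_subset.2 h)))

namespace PolyModBasic

variable {X Y : ModuleCat.{w} (MvPolynomial (Fin n) k)} {f : X ⟶ Y}

theorem isStdPresented (hf : PolyModBasic k n f) : IsStdPresented X ∧ IsStdPresented Y := by
  cases hf with
  | var | const => exact ⟨isStdPresented_self, isStdPresented_self⟩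
  | inl | inr | diag => exact ⟨isStdPresented_self, isStdPresented_prod⟩
  | add => exact ⟨isStdPresented_prod, isStdPresented_self⟩
  | zero => exact ⟨isStdPresented_self, isStdPresented_punit⟩

theorem exists_matrix (hf : PolyModBasic k n f) :
    ∃ J : Finset (Fin n), J.card ≤ 1 ∧ ∃ B : Matrix (Fin 2) (Fin 2) (MvPolynomial (Fin n) k),
      (∀ i j, B i j ∈ affineForms k J) ∧ ∀ i, f.hom (stdGen X i) = ∑ j, B i j • stdGen Y j := by
  have h0 (J : Finset (Fin n)) : 0 ∈ affineForms k J := Submodule.zero_mem _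
  have h1 (J : Finset (Fin n)) : 1 ∈ affineForms k J := one_mem_affineForms J
  cases hf with
  | var l =>
    exact ⟨{l}, by simp, !![.X l, 0; 0, 0], by simp [Fin.forall_fin_two, h0, X_mem_affineForms],
      by simp [Fin.forall_fin_two, Fin.sum_univ_two, stdGen_self]⟩
  | const c =>
    exact ⟨∅, by simp, !![.C c, 0; 0, 0], by simp [Fin.forall_fin_two, h0, C_mem_affineForms],
      by simp [Fin.forall_fin_two, Fin.sum_univ_two, stdGen_self]⟩
  | inl =>
    exact ⟨∅, by simp, !![1, 0; 0, 0], by simp [Fin.forall_fin_two, h0, h1],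
      by simp [Fin.forall_fin_two, Fin.sum_univ_two, stdGen_self, stdGen_prod]⟩
  | inr =>
    exact ⟨∅, by simp, !![0, 1; 0, 0], by simp [Fin.forall_fin_two, h0, h1],
      by simp [Fin.forall_fin_two, Fin.sum_univ_two, stdGen_self, stdGen_prod]⟩
  | diag =>
    exact ⟨∅, by simp, !![1, 1; 0, 0], by simp [Fin.forall_fin_two, h0, h1],
      by simp [Fin.forall_fin_two, Fin.sum_univ_two, stdGen_self, stdGen_prod]⟩
  | add =>
    exact ⟨∅, by simp, !![1, 0; 1, 0], by simp [Fin.forall_fin_two, h0, h1],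
      by simp [Fin.forall_fin_two, Fin.sum_univ_two, stdGen_self, stdGen_prod]⟩
  | zero =>
    exact ⟨∅, by simp, 0, fun _ _ => h0 _, fun _ => Subsingleton.elim (α := PUnit.{w + 1}) _ _⟩

end PolyModBasic

end AffineForms

section GenericAffineMatrix

/-- The `ι × κ` matrix of affine linear forms in `m` variables whose coefficients are
indeterminates. -/
noncomputable def genericAffineMatrix (ι κ : Type) (m : ℕ) :
    Matrix ι κ (MvPolynomial (Fin m) (MvPolynomial (ι × κ × Option (Fin m)) ℤ)) := fun i j =>
  .C (.X (i, j, none)) + ∑ l, .C (.X (i, j, some l)) * .X l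

variable {k : Type w} [Field k] {n m : ℕ}

theorem specialize_genericAffineMatrix {ι κ : Type} (c : ι × κ × Option (Fin m) → k)
    (g : Fin m → Fin n) (i : ι) (j : κ) :
    specialize (MvPolynomial.eval₂Hom (Int.castRingHom k) c) g (genericAffineMatrix ι κ m i j) =
      MvPolynomial.C (c (i, j, none)) +
        ∑ l, MvPolynomial.C (c (i, j, some l)) * MvPolynomial.X (g l) := by
  simp [genericAffineMatrix, specialize_C, specialize_X]

theorem exists_eq_of_mem_affineForms {J : Finset (Fin n)} (hJ : J.card = m)
    {r : MvPolynomial (Fin n) k} (h : r ∈ affineForms k J) : ∃ c : Option (Fin m) → k,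
      MvPolynomial.C (c none) +
        ∑ l, MvPolynomial.C (c (some l)) * MvPolynomial.X (J.orderEmbOfFin hJ l) = r := by
  induction h using Submodule.span_induction with
  | mem r hr =>
    rcases hr with rfl | ⟨i, hi, rfl⟩
    · exact ⟨fun o => o.elim 1 fun _ => 0, by simp⟩
    · obtain ⟨l, rfl⟩ : i ∈ Set.range (J.orderEmbOfFin hJ) := by
        rwa [Finset.range_orderEmbOfFin]
      refine ⟨fun o => o.elim 0 fun l' => if l' = l then 1 else 0, ?_⟩
      simp [apply_ite MvPolynomial.C, ite_mul]
  | zero => exact ⟨0, by simp⟩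
  | add r s _ _ hr hs =>
    obtain ⟨c, rfl⟩ := hr
    obtain ⟨d, rfl⟩ := hs
    refine ⟨c + d, ?_⟩
    simp only [Pi.add_apply, map_add, add_mul, Finset.sum_add_distrib]
    ring
  | smul a r _ hr =>
    obtain ⟨c, rfl⟩ := hr
    refine ⟨a • c, ?_⟩
    simp only [Pi.smul_apply, smul_eq_mul, map_mul, MvPolynomial.smul_eq_C_mul, mul_add,
      Finset.mul_sum, mul_assoc]

theorem exists_forall_computes_subtype_of_affine (ι κ μ : Type) [Fintype ι] [Finite κ] [Finite μ]
    (m : ℕ) : ∃ b : ℕ, ∀ (k : Type w) [Field k] (n : ℕ)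
      (N : ModuleCat.{w} (MvPolynomial (Fin n) k)) (L : Submodule (MvPolynomial (Fin n) k) N)
      (x : ι → N) (M : Matrix ι (κ ⊕ μ) (MvPolynomial (Fin n) k)) (J : Finset (Fin n)),
      J.card = m → (∀ i j, M i j ∈ affineForms k J) →
      IsPresentation x (Set.range fun r i => M i (Sum.inr r)) →
      Submodule.span _ (Set.range fun j => ∑ i, M i (Sum.inl j) • x i) = L →
      ∃ Q : ColimitComputation (PolyModBasic k n),
        Q.Computes (morphismDiagram (ModuleCat.ofHom L.subtype)) ∧ Q.size ≤ b := by
  obtain ⟨b, hb⟩ := exists_forall_computes_subtype.{w} (genericAffineMatrix ι (κ ⊕ μ) m)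
  refine ⟨b, fun k _ n N L x M J hJ hM hx hL => ?_⟩
  choose c hc using fun i j => exists_eq_of_mem_affineForms hJ (hM i j)
  have hM' (i j) : specialize (MvPolynomial.eval₂Hom (Int.castRingHom k)
      fun t : ι × (κ ⊕ μ) × Option (Fin m) => c t.1 t.2.1 t.2.2) (J.orderEmbOfFin hJ)
      (genericAffineMatrix ι (κ ⊕ μ) m i j) = M i j :=
    (specialize_genericAffineMatrix _ _ i j).trans (hc i j)
  simp only [← hM'] at hx hL
  exact hb k _ n _ (J.orderEmbOfFin hJ).injective N x hx L hL

end GenericAffineMatrix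

theorem IsPresentation.comp_equiv {R N ι κ : Type*} [CommRing R] [AddCommGroup N] [Module R N]
    [Fintype ι] [Fintype κ] {x : ι → N} {Z : Set (ι → R)} (h : IsPresentation x Z) (ε : κ ≃ ι) :
    IsPresentation (x ∘ ε) ((· ∘ ε) '' Z) := by
  have hcomb : Fintype.linearCombination R (x ∘ ε) =
      Fintype.linearCombination R x ∘ₗ (LinearEquiv.funCongrLeft R R ε).symm.toLinearMap := by
    ext i
    simp only [LinearMap.comp_apply, LinearEquiv.coe_coe, LinearEquiv.funCongrLeft_symm,
      LinearEquiv.funCongrLeft_apply, LinearMap.funLeft_apply, Fintype.linearCombination_apply]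
    exact Fintype.sum_equiv ε _ _ fun j => by simp
  refine ⟨by rw [ε.surjective.range_comp, h.span_range_eq_top], ?_⟩
  rw [hcomb, LinearMap.ker_comp, h.ker_eq_span, ← Submodule.map_equiv_eq_comap_symm,
    Submodule.map_span]
  rfl

section AffinePresentation

variable {k : Type w} [Field k] {n : ℕ} {N : ModuleCat.{w} (MvPolynomial (Fin n) k)}

/-- A presentation of `N` by generators and relations together with generators of its submodule `L`,
all of whose coefficients are affine linear forms in the variables from `vars`. The columns of
`coeff` are the generators of `L` and the relations of `N`. -/
structure AffinePresentation (L : Submodule (MvPolynomial (Fin n) k) N) where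
  /-- the index type of the generators of `N` -/
  Gen : Type
  /-- the index type of the generators of `L` -/
  SubGen : Type
  /-- the index type of the relations of `N` -/
  Rel : Type
  [fintypeGen : Fintype Gen]
  [finiteSubGen : Finite SubGen]
  [finiteRel : Finite Rel]
  vars : Finset (Fin n)
  gen : Gen → N
  coeff : Matrix Gen (SubGen ⊕ Rel) (MvPolynomial (Fin n) k)
  coeff_mem : ∀ i j, coeff i j ∈ affineForms k vars
  isPresentation : IsPresentation gen (Set.range fun r i => coeff i (Sum.inr r))
  span_eq : Submodule.span _ (Set.range fun j => ∑ i, coeff i (Sum.inl j) • gen i) = L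

attribute [instance] AffinePresentation.fintypeGen AffinePresentation.finiteSubGen
  AffinePresentation.finiteRel

namespace AffinePresentation

variable {L : Submodule (MvPolynomial (Fin n) k) N}

/-- The largest among the numbers of variables, generators and relations in the presentation. -/
noncomputable def size (F : AffinePresentation L) : ℕ :=
  max (max F.vars.card (Nat.card F.Gen)) (max (Nat.card F.SubGen) (Nat.card F.Rel))

theorem size_le_iff {F : AffinePresentation L} {s : ℕ} : F.size ≤ s ↔
    (F.vars.card ≤ s ∧ Nat.card F.Gen ≤ s) ∧ Nat.card F.SubGen ≤ s ∧ Nat.card F.Rel ≤ s := by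
  simp only [size, max_le_iff]

theorem exists_forall_computes_subtype_of_card (m p q l : ℕ) : ∃ b : ℕ, ∀ (k : Type w) [Field k]
    (n : ℕ) (N : ModuleCat.{w} (MvPolynomial (Fin n) k)) (L : Submodule (MvPolynomial (Fin n) k) N)
    (F : AffinePresentation L), F.vars.card = m → Nat.card F.Gen = p → Nat.card F.SubGen = q →
    Nat.card F.Rel = l → ∃ Q : ColimitComputation (PolyModBasic k n),
      Q.Computes (morphismDiagram (ModuleCat.ofHom L.subtype)) ∧ Q.size ≤ b := by
  obtain ⟨b, hb⟩ := exists_forall_computes_subtype_of_affine.{w} (Fin p) (Fin q) (Fin l) m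
  refine ⟨b, fun k _ n N L F hm hp hq hl => ?_⟩
  let ε : Fin p ≃ F.Gen := (Finite.equivFinOfCardEq hp).symm
  let ε₁ : Fin q ≃ F.SubGen := (Finite.equivFinOfCardEq hq).symm
  let ε₂ : Fin l ≃ F.Rel := (Finite.equivFinOfCardEq hl).symm
  refine hb k n N L (F.gen ∘ ε) (F.coeff.submatrix ε (Sum.map ε₁ ε₂)) F.vars hm
    (fun i j => F.coeff_mem _ _) ?_ ?_
  · convert F.isPresentation.comp_equiv ε using 1
    rw [← Set.range_comp, ← ε₂.surjective.range_comp]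
    rfl
  · refine Eq.trans ?_ F.span_eq
    rw [← ε₁.surjective.range_comp]
    congr 2 with j
    exact ε.sum_comp fun i => F.coeff i (Sum.inl (ε₁ j)) • F.gen i

variable (w) in
theorem exists_forall_computes_subtype_of_size_le (s : ℕ) : ∃ b : ℕ, ∀ (k : Type w) [Field k]
    (n : ℕ) (N : ModuleCat.{w} (MvPolynomial (Fin n) k)) (L : Submodule (MvPolynomial (Fin n) k) N)
    (F : AffinePresentation L), F.size ≤ s → ∃ Q : ColimitComputation (PolyModBasic k n),
      Q.Computes (morphismDiagram (ModuleCat.ofHom L.subtype)) ∧ Q.size ≤ b := by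
  choose b hb using exists_forall_computes_subtype_of_card.{w}
  let S := Finset.range (s + 1)
  refine ⟨(S ×ˢ S ×ˢ S ×ˢ S).sup fun t => b t.1 t.2.1 t.2.2.1 t.2.2.2, fun k _ n N L F hF => ?_⟩
  obtain ⟨⟨hm, hp⟩, hq, hl⟩ := size_le_iff.1 hF
  obtain ⟨Q, hQ, hsize⟩ := hb _ _ _ _ k n N L F rfl rfl rfl rfl
  refine ⟨Q, hQ, hsize.trans (Finset.le_sup (f := fun t : ℕ × ℕ × ℕ × ℕ =>
    b t.1 t.2.1 t.2.2.1 t.2.2.2) (b := (_, _, _, _)) ?_)⟩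
  simp only [S, Finset.mem_product, Finset.mem_range, Nat.lt_succ_iff]
  exact ⟨hm, hp, hq, hl⟩

end AffinePresentation

end AffinePresentation

theorem IsPresentation.range_eq_span {R N N' ι : Type*} [CommRing R] [AddCommGroup N] [Module R N]
    [AddCommGroup N'] [Module R N'] [Fintype ι] {x : ι → N} {Z : Set (ι → R)}
    (h : IsPresentation x Z) (f : N →ₗ[R] N') :
    LinearMap.range f = Submodule.span R (Set.range fun i => f (x i)) := by
  rw [LinearMap.range_eq_map, ← h.span_range_eq_top, Submodule.map_span, ← Set.range_comp]
  rfl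

theorem IsColimitOn.iSup_range_eq_top {R : Type w} [CommRing R] {V : Type} [Quiver.{0} V]
    {D : V ⥤q ModuleCat.{w} R} {J : DiSubgraph V} {W : ModuleCat.{w} R}
    {leg : ∀ a : J.verts, D.obj a.1 ⟶ W} (h : IsColimitOn D J W leg) :
    ⨆ a, LinearMap.range (leg a).hom = ⊤ := by
  set L := ⨆ a, LinearMap.range (leg a).hom
  have hzero : ModuleCat.ofHom L.mkQ = 0 := h.hom_ext fun a => by
    ext y
    exact (Submodule.Quotient.mk_eq_zero L).2
      (Submodule.mem_iSup_of_mem a (LinearMap.mem_range_self (leg a).hom y))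
  rw [← L.ker_mkQ, LinearMap.ker_eq_top]
  exact congrArg ModuleCat.Hom.hom hzero

namespace ColimitComputation

section Range

variable {R : Type w} [CommRing R] {A : MorphismProperty (ModuleCat.{w} R)}
  (P : ColimitComputation A)

theorem exists_range_map_leg_eq (i : Fin P.steps) (b : (P.sub i).verts) :
    ∃ T : Set (P.basicSub i).verts, LinearMap.range (P.diagram.map (P.leg i b)).hom =
      ⨆ c ∈ T, LinearMap.range (P.basicLeg i c).hom := by
  rcases b with ⟨b, hb⟩
  rcases P.mem_shape_verts ((P.sub_full i).1.1 hb) with h0 | ⟨m, rfl⟩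
  · refine ⟨{⟨b, hb, h0⟩}, ?_⟩
    rw [iSup_singleton]
    rfl
  · let ι (c : (P.basicSub m).verts) : (P.basicSub i).verts :=
      ⟨c.1, P.mem_basicSub_of_apex_mem_sub hb c.2⟩
    refine ⟨Set.range ι, ?_⟩
    rw [iSup_range, LinearMap.range_eq_map]
    refine (congrArg (Submodule.map _) (P.isColimitOn_basicSub m).iSup_range_eq_top.symm).trans ?_
    rw [Submodule.map_iSup]
    refine iSup_congr fun c => ?_
    rw [← LinearMap.range_comp]
    exact congrArg (fun f => LinearMap.range f.hom) (P.map_leg_comp_map_leg hb ⟨c.1, c.2.1⟩)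

end Range

section Size

variable {C : Type u} [Category.{v} C] {A : MorphismProperty C} (P : ColimitComputation A)

theorem ncard_edges_le_size : (P.shape 0).edges.ncard ≤ P.size := Nat.le_add_left _ _

theorem ncard_verts_le_two_mul_size : (P.shape 0).verts.ncard ≤ 2 * P.size := by
  have hsub : (P.shape 0).verts ⊆ Quiver.Total.left '' (P.shape 0).edges ∪
      Quiver.Total.right '' (P.shape 0).edges := by
    intro a ha
    obtain ⟨e, he, h | h⟩ := P.no_isolated a ha
    · exact .inl ⟨e, he, h⟩
    · exact .inr ⟨e, he, h⟩
  calc (P.shape 0).verts.ncard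
      ≤ (Quiver.Total.left '' (P.shape 0).edges).ncard +
          (Quiver.Total.right '' (P.shape 0).edges).ncard :=
        (Set.ncard_le_ncard hsub (Set.toFinite _)).trans (Set.ncard_union_le _ _)
    _ ≤ P.size + P.size := add_le_add
        ((Set.ncard_image_le (Set.toFinite _)).trans P.ncard_edges_le_size)
        ((Set.ncard_image_le (Set.toFinite _)).trans P.ncard_edges_le_size)
    _ = 2 * P.size := (two_mul _).symm

variable {P} {J : DiSubgraph P.V}

theorem card_verts_le_two_mul_size (h : J ≤ P.shape 0) : Nat.card J.verts ≤ 2 * P.size :=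
  (Set.ncard_le_ncard h.1 (Set.toFinite _)).trans P.ncard_verts_le_two_mul_size

theorem card_edges_le_size (h : J ≤ P.shape 0) : Nat.card J.edges ≤ P.size :=
  (Set.ncard_le_ncard h.2 (Set.toFinite _)).trans P.ncard_edges_le_size

end Size

section AffineCoordinates

variable {k : Type w} [Field k] {n : ℕ} {P : ColimitComputation (PolyModBasic k n)}

/-- The initial diagram in coordinates: relations between the standard generators at its vertices
and matrices of its edges, whose coefficients are affine linear forms in the variables from `vars`.
The values of `rel` and `mat` outside of the initial diagram carry no information. -/
structure AffineCoordinates (P : ColimitComputation (PolyModBasic k n)) where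
  vars : Finset (Fin n)
  rel : P.V → Matrix (Fin 2) (Fin 2) (MvPolynomial (Fin n) k)
  mat : Quiver.Total P.V → Matrix (Fin 2) (Fin 2) (MvPolynomial (Fin n) k)
  rel_mem : ∀ a r i, rel a r i ∈ affineForms k vars
  mat_mem : ∀ e i j, mat e i j ∈ affineForms k vars
  isPresentation : ∀ a ∈ (P.shape 0).verts,
    IsPresentation (stdGen (P.diagram.obj a)) (Set.range (rel a))
  map_stdGen : ∀ e ∈ (P.shape 0).edges, ∀ i,
    (P.diagram.map e.hom).hom (stdGen _ i) = ∑ j, mat e i j • stdGen _ j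

variable (P) in
theorem exists_affineCoordinates : ∃ K : P.AffineCoordinates, K.vars.card ≤ P.size := by
  classical
  have hvert (a : P.V) : ∃ Z : Matrix (Fin 2) (Fin 2) (MvPolynomial (Fin n) k),
      (∀ r i, Z r i = 0 ∨ Z r i = 1) ∧ (a ∈ (P.shape 0).verts →
        IsPresentation (stdGen (P.diagram.obj a)) (Set.range Z)) := by
    by_cases ha : a ∈ (P.shape 0).verts
    · have hstd : IsStdPresented (P.diagram.obj a) := by
        obtain ⟨e, he, rfl | rfl⟩ := P.no_isolated a ha
        · exact (P.basic e he).isStdPresented.1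
        · exact (P.basic e he).isStdPresented.2
      exact hstd.imp fun _ h => ⟨h.1, fun _ => h.2⟩
    · exact ⟨0, fun _ _ => .inl rfl, fun h => absurd h ha⟩
  have hedge (e : Quiver.Total P.V) : ∃ J : Finset (Fin n), J.card ≤ 1 ∧
      ∃ B : Matrix (Fin 2) (Fin 2) (MvPolynomial (Fin n) k),
        (∀ i j, B i j ∈ affineForms k J) ∧ (e ∈ (P.shape 0).edges → ∀ i,
          (P.diagram.map e.hom).hom (stdGen _ i) = ∑ j, B i j • stdGen _ j) ∧
        (e ∉ (P.shape 0).edges → B = 0) := by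
    by_cases he : e ∈ (P.shape 0).edges
    · obtain ⟨J, hJ, B, hB, h⟩ := (P.basic e he).exists_matrix
      exact ⟨J, hJ, B, hB, fun _ => h, fun h => absurd he h⟩
    · exact ⟨∅, by simp, 0, fun _ _ => Submodule.zero_mem _, fun h => absurd h he, fun _ => rfl⟩
  choose Z hZ hpres using hvert
  choose J hJ B hB hmap hzero using hedge
  have hfin := Set.toFinite (P.shape 0).edges
  refine ⟨⟨hfin.toFinset.biUnion J, Z, B, fun a r i => ?_, fun e i j => ?_, hpres, hmap⟩, ?_⟩
  · rcases hZ a r i with h | h <;> rw [h]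
    exacts [Submodule.zero_mem _, one_mem_affineForms _]
  · by_cases he : e ∈ (P.shape 0).edges
    · exact affineForms_mono (Finset.subset_biUnion_of_mem J (hfin.mem_toFinset.2 he)) (hB e i j)
    · rw [hzero e he]
      exact Submodule.zero_mem _
  · refine (Finset.card_biUnion_le_card_mul _ _ 1 fun e _ => hJ e).trans ?_
    rw [mul_one, ← Set.ncard_eq_toFinset_card _ hfin]
    exact P.ncard_edges_le_size

namespace AffineCoordinates

variable (K : P.AffineCoordinates)

/-- The presentation of the target and the image of an edge of the initial diagram. -/
noncomputable def edgePresentation (e : Quiver.Total P.V) (he : e ∈ (P.shape 0).edges) :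
    AffinePresentation (LinearMap.range (P.diagram.map e.hom).hom) where
  Gen := Fin 2
  SubGen := Fin 2
  Rel := Fin 2
  vars := K.vars
  gen := stdGen _
  coeff i := Sum.elim (K.mat e · i) (K.rel e.right · i)
  coeff_mem i := by
    rintro (j | r)
    exacts [K.mat_mem e j i, K.rel_mem e.right r i]
  isPresentation := K.isPresentation _ ((P.shape 0).right_mem e he)
  span_eq := by
    rw [(K.isPresentation _ ((P.shape 0).left_mem e he)).range_eq_span]
    simp only [Sum.elim_inl, K.map_stdGen e he]

theorem size_edgePresentation_le (hK : K.vars.card ≤ P.size) (e : Quiver.Total P.V)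
    (he : e ∈ (P.shape 0).edges) : (K.edgePresentation e he).size ≤ 6 * P.size := by
  have hpos : 1 ≤ P.size :=
    ((Set.ncard_pos (Set.toFinite _)).2 ⟨e, he⟩).trans_le P.ncard_edges_le_size
  rw [AffinePresentation.size_le_iff]
  simp only [edgePresentation, Nat.card_fin]
  omega

theorem isPresentation_basicLeg (l : Fin P.steps) [Fintype (P.basicSub l).verts] :
    IsPresentation (fun p : (P.basicSub l).verts × Fin 2 => (P.basicLeg l p.1).hom (stdGen _ p.2))
      (Set.range (gluingRelation (P.basicSub l) K.rel K.mat)) :=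
  (P.isColimitOn_basicSub l).isPresentation
    (fun a ha => K.isPresentation a ((P.basicSub_le l).1 ha))
    fun e he => K.map_stdGen e ((P.basicSub_le l).2 he)

open Classical in
/-- The presentation of a colimit of the computation, as a module glued from modules of the initial
diagram, and of its submodule generated by the modules at the vertices in `T`. -/
noncomputable def legPresentation (l : Fin P.steps) (T : Set (P.basicSub l).verts) :
    AffinePresentation (⨆ c ∈ T, LinearMap.range (P.basicLeg l c).hom) :=
  letI := Fintype.ofFinite (P.basicSub l).verts
  { Gen := (P.basicSub l).verts × Fin 2
    SubGen := T × Fin 2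
    Rel := ((P.basicSub l).verts × Fin 2) ⊕ ((P.basicSub l).edges × Fin 2)
    vars := K.vars
    gen p := (P.basicLeg l p.1).hom (stdGen _ p.2)
    coeff p := Sum.elim (fun q => (Pi.single (q.1.1, q.2) 1 : _ → MvPolynomial (Fin n) k) p)
      (gluingRelation (P.basicSub l) K.rel K.mat · p)
    coeff_mem p := by
      rintro (q | r)
      · rw [Sum.elim_inl, Pi.single_apply]
        split_ifs
        exacts [one_mem_affineForms _, Submodule.zero_mem _]
      · exact gluingRelation_mem (S := (affineForms k K.vars).toAddSubgroup)
          (one_mem_affineForms _) K.rel_mem K.mat_mem r p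
    isPresentation := K.isPresentation_basicLeg l
    span_eq := by
      simp only [fun c : (P.basicSub l).verts =>
        (K.isPresentation _ ((P.basicSub_le l).1 c.2)).range_eq_span (P.basicLeg l c).hom,
        ← Submodule.span_iUnion, Sum.elim_inl, ite_smul, one_smul, zero_smul, Pi.single_apply,
        Finset.sum_ite_eq', Finset.mem_univ, if_true]
      congr 1
      ext y
      constructor
      · rintro ⟨q, rfl⟩
        exact Set.mem_iUnion₂.2 ⟨q.1.1, q.1.2, q.2, rfl⟩
      · intro hy
        obtain ⟨c, hc, i, rfl⟩ := Set.mem_iUnion₂.1 hy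
        exact ⟨(⟨c, hc⟩, i), rfl⟩ }

theorem size_legPresentation_le (hK : K.vars.card ≤ P.size) (l : Fin P.steps)
    (T : Set (P.basicSub l).verts) : (K.legPresentation l T).size ≤ 6 * P.size := by
  have hverts := card_verts_le_two_mul_size (P.basicSub_le l)
  have hedges := card_edges_le_size (P.basicSub_le l)
  have hT : Nat.card T ≤ Nat.card (P.basicSub l).verts := Finite.card_subtype_le _
  rw [AffinePresentation.size_le_iff]
  simp only [legPresentation, Nat.card_prod, Nat.card_sum, Nat.card_fin]
  omega

end AffineCoordinates

variable (P) in
theorem exists_affinePresentation_range (e : Quiver.Total P.V) :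
    ∃ F : AffinePresentation (LinearMap.range (P.diagram.map e.hom).hom),
      F.size ≤ 6 * P.size := by
  obtain ⟨K, hK⟩ := P.exists_affineCoordinates
  have he : e ∈ (P.shape (Fin.last P.steps)).edges := P.shape_last_edges.ge (Set.mem_univ e)
  rcases P.mem_shape_edges he with h0 | ⟨l, b, rfl⟩
  · exact ⟨K.edgePresentation e h0, K.size_edgePresentation_le hK e h0⟩
  · obtain ⟨T, hT⟩ := P.exists_range_map_leg_eq l b
    change ∃ F : AffinePresentation (LinearMap.range (P.diagram.map (P.leg l b)).hom), _
    rw [hT]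
    exact ⟨K.legPresentation l T, K.size_legPresentation_le hK l T⟩

end AffineCoordinates

end ColimitComputation

theorem ColimitComputation.Computes.of_iso {C : Type u} [Category.{v} C] {A : MorphismProperty C}
    {Q : ColimitComputation A} {S : Type} [Quiver.{0} S] {F G : S ⥤q C} (hF : Q.Computes F)
    (β : ∀ a, G.obj a ≅ F.obj a)
    (hβ : ∀ (a b : S) (e : a ⟶ b), G.map e ≫ (β b).hom = (β a).hom ≫ F.map e) :
    Q.Computes G := by
  obtain ⟨g, hobj, hmap, α, hα⟩ := hF
  refine ⟨g, hobj, hmap, fun a => β a ≪≫ α a, fun a b e => ?_⟩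
  simp only [Iso.trans_hom, Category.assoc, ← hα a b e]
  rw [← Category.assoc, hβ, Category.assoc]

theorem ColimitComputation.Computes.morphismDiagram_of_iso {C : Type u} [Category.{v} C]
    {A : MorphismProperty C} {Q : ColimitComputation A} {X Y X' Y' : C} {f : X ⟶ Y} {f' : X' ⟶ Y'}
    (h : Q.Computes (morphismDiagram f)) (α : X' ≅ X) (β : Y' ≅ Y)
    (hf : f' ≫ β.hom = α.hom ≫ f) : Q.Computes (morphismDiagram f') := by
  refine h.of_iso (fun a => match a with
    | .source => α
    | .target => β) ?_
  rintro _ _ ⟨⟩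
  exact hf

theorem range_map_iso {R : Type w} [CommRing R] {M N M' N' : ModuleCat.{w} R} {φ : M ⟶ N}
    {ψ : M' ⟶ N'} (α : M ≅ M') (β : N ≅ N') (h : φ ≫ β.hom = α.hom ≫ ψ) :
    (LinearMap.range φ.hom).map β.toLinearEquiv.toLinearMap = LinearMap.range ψ.hom := by
  have hsurj : LinearMap.range α.hom.hom = ⊤ :=
    LinearMap.range_eq_top.2 α.toLinearEquiv.surjective
  rw [← LinearMap.range_comp_of_range_eq_top ψ.hom hsurj, ← LinearMap.range_comp]
  exact congrArg (fun f => LinearMap.range f.hom) h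

theorem ColimitComputation.Computes.subtype_range_of_iso {R : Type w} [CommRing R]
    {A : MorphismProperty (ModuleCat.{w} R)} {Q : ColimitComputation A}
    {M N M' N' : ModuleCat.{w} R} {φ : M ⟶ N} {ψ : M' ⟶ N'}
    (hQ : Q.Computes (morphismDiagram (ModuleCat.ofHom (LinearMap.range ψ.hom).subtype)))
    (α : M ≅ M') (β : N ≅ N') (h : φ ≫ β.hom = α.hom ≫ ψ) :
    Q.Computes (morphismDiagram (ModuleCat.ofHom (LinearMap.range φ.hom).subtype)) :=
  hQ.morphismDiagram_of_iso
    (β.toLinearEquiv.ofSubmodules _ _ (range_map_iso α β h)).toModuleIso β rfl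

theorem mainTheorem11 :
    ∃ bound : ℕ → ℕ,
      ∀ (k : Type w) [Field k] (n : ℕ) (M N : ModuleCat.{w} (MvPolynomial (Fin n) k)) (φ : M ⟶ N)
        (P : ColimitComputation (PolyModBasic k n)),
        P.Computes (morphismDiagram φ) →
        ∃ Q : ColimitComputation (PolyModBasic k n),
          Q.Computes (morphismDiagram (ModuleCat.ofHom (LinearMap.range φ.hom).subtype)) ∧
          Q.size ≤ bound P.size := by
  choose b hb using AffinePresentation.exists_forall_computes_subtype_of_size_le.{w}
  refine ⟨fun s => b (6 * s), ?_⟩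
  rintro k _ n M N φ P ⟨g, -, -, α, hα⟩
  obtain ⟨F, hF⟩ := P.exists_affinePresentation_range ⟨_, _, g.map ArrowGraph.Edge.edge⟩
  obtain ⟨Q, hQ, hsize⟩ := hb _ k n _ _ F hF
  exact ⟨Q, hQ.subtype_range_of_iso (α .source) (α .target) (hα .source .target .edge), hsize⟩
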